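/- **Setting.** Consider a nonlinear system $\dot x=f(x,u)$, $y=C(t)x$ for $t\ge 0$, with $x(t)\in\mathbb R^n$, $u(t)\in\mathbb R^m$, $y(t)\in\mathbb R^p$, where $f$ is differentiable in $x$ and $C:[0,\infty)\to\mathbb R^{p\times n}$ is bounded. Norms are 2-norms and induced 2-norms, and $M_1\preceq M_2$ means that $M_2-M_1$ is symmetric positive semidefinite. Solutions of differential equations are continuous and satisfy the equation except possibly at finitely many times in each bounded interval. For a square matrix $M$ let $\operatorname{skew}(M)$ be the skew-symmetric matrix with entries $M_{ij}$ for $i>j$. The *extended subspace observer* with $k\le n$ columns is $$\dot{\hat x}=f(\hat x,u)+L(t)\,[\,y-C(t)\hat x\,],\qquad L=\bar Q P_1\bar C^{\top},\quad \bar C=C\bar Q,$$ $$\dot P_1=B_1P_1+P_1B_1^{\top}-P_1\bar C^{\top}\bar C P_1+G_1(t),\qquad P_1(t)\in\mathbb R^{k\times k},\quad P_1(0)\succ 0,$$ $$\dot{\bar Q}=(I_n-\bar Q\bar Q^{\top})A(t)\bar Q+\bar Q S_1,\qquad \bar Q(t)\in\mathbb R^{n\times k},\quad \bar Q(0)^{\top}\bar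 Q(0)=I_k,$$ with $A(t)=\frac{\partial f}{\partial x}(\hat x(t),u(t))$, $S_1=\operatorname{skew}(\bar Q^{\top}A\bar Q)$, $B_1=\bar Q^{\top}A\bar Q-S_1$, and $g_1I_k\preceq G_1(t)\preceq g_2I_k$ for constants $0<g_1\le g_2$. Fix a solution $x$ of the system and a solution $(\hat x,\bar Q,P_1)$ of the observer driven by $y=Cx$, both on $[0,\infty)$, such that $A$ is continuous except at finitely many times in each bounded interval. Let $Q(t)=[\bar Q(t)\ \ \bar Q_\perp(t)]\in\mathbb R^{n\times n}$ solve $\dot Q=Q\operatorname{skew}(Q^{\top}AQ)$ with $Q(0)$ orthogonal, let $q_i$ be the columns of $Q$, and let $$\beta_i^{\mathrm s}=\limsup_{t_0\to\infty,\ s\to\infty}\frac1s\int_{t_0}^{t_0+s}q_i(\tau)^{\top}A(\tau)q_i(\tau)\,d\tau$$ be the upper Bohl exponents. The number $k$ is chosen such that $j^\star\le k$, where $j^\star\in\{0,\dots,n\}$ is the smallest integer with $\beta^{\mathrm s}_i<0$ for all $i=j^\star+1,\dots,n$. Let $\eta(e,z,v)=f(z+e,v)-f(z,v)-\frac{\partial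 f}{\partial x}(z,v)\,e$. **Theorem (extended subspace observer).** Assume that - (a1) $A$ is bounded on $[0,\infty)$; - (a2) there are constants $p_1,p_2>0$ with $p_1I_k\preceq P_1(t)\preceq p_2I_k$ for all $t\ge 0$; - (a3) there are constants $\epsilon,\kappa>0$ with $\|\eta(e,z,v)\|\le\kappa\|e\|^2$ for all $z,e\in\mathbb R^n$, $v\in\mathbb R^m$ with $\|e\|\le\epsilon$. Then $e=x-\hat x$ is a solution of the estimation error dynamics $$\dot e=[A(t)-L(t)C(t)]\,e+\eta(e,\hat x(t),u(t)),$$ and this time-varying differential equation (with $\hat x,u,\bar Q,P_1$ the fixed functions of time above) is locally uniformly exponentially stable: $0$ is an equilibrium, and there are $\mu>0$, $\rho>0$, $K\ge1$ such that for all $0\le t_0\le T$ every solution $e$ on $[t_0,T]$ with $\|e(t_0)\|\le\rho$ satisfies $\|e(t)\|\le Ke^{-\mu(t-t_0)}\|e(t_0)\|$ for all $t\in[t_0,T]$. -/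

import Mathlib

open scoped Matrix Matrix.Norms.L2Operator

noncomputable section

/-- Euclidean space `ℝⁿ` (with the 2-norm). -/
abbrev Vec (n : ℕ) : Type := EuclideanSpace ℝ (Fin n)

/-- Real `n × k` matrices; their norm `‖M‖` is the one induced by the 2-norms. -/
abbrev Mat (n k : ℕ) : Type := Matrix (Fin n) (Fin k) ℝ

/-- The product `M v` of a matrix and a vector. -/
abbrev matVec {n k : ℕ} (M : Mat n k) (v : Vec k) : Vec n := Matrix.toEuclideanLin M v

/-- The order `M₁ ⪯ M₂`. With `M₁` symmetric it includes that `M₂` is symmetric. -/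
def LoewnerLE {k : ℕ} (M₁ M₂ : Mat k k) : Prop := (M₂ - M₁).PosSemidef

/-- `D` has finitely many points in every bounded interval `[0, T]`. -/
def LocallyFiniteTimes (D : Set ℝ) : Prop := ∀ T : ℝ, (D ∩ Set.Icc 0 T).Finite

/-- `A` is continuous on `[0, ∞)` except at a locally finite set of times. -/
def PiecewiseContinuous {n k : ℕ} (A : ℝ → Mat n k) : Prop :=
  ∃ D : Set ℝ, LocallyFiniteTimes D ∧
    ∀ t : ℝ, 0 ≤ t → t ∉ D → ContinuousWithinAt A (Set.Ici 0) t

/-- `ẋ = v` on the interval `I ⊆ [0, ∞)`, in the sense used for differential equations with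
piecewise continuous data: `x` is continuous, and `ẋ(t) = v(t)` (one-sided at the end points)
except at a locally finite set of times. A classical solution has no exceptional times. -/
def SolvesOn {E : Type} [NormedAddCommGroup E] [NormedSpace ℝ E] (I : Set ℝ)
    (x v : ℝ → E) : Prop :=
  ContinuousOn x I ∧ ∃ D : Set ℝ, LocallyFiniteTimes D ∧
    ∀ t ∈ I, t ∉ D → HasDerivWithinAt x (v t) I t

/-- `Ṁ = V` on `[0, ∞)` for matrix-valued curves, entry by entry. -/
def MatSolves {n k : ℕ} (M V : ℝ → Mat n k) : Prop :=
  ∀ i j, SolvesOn (Set.Ici 0) (fun t => M t i j) (fun t => V t i j)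

/-! ### Stability -/

/-- The origin is an equilibrium of `ė = F(t, e)`, `t ≥ 0`, and it is locally uniformly
exponentially stable: the constants do not depend on the initial time `t₀`. The estimate is
required of every solution on every interval `[t₀, T]`, hence of every solution on `[t₀, ∞)`. -/
def LocallyUniformlyExpStable {n : ℕ} (F : ℝ → Vec n → Vec n) : Prop :=
  (∀ t : ℝ, 0 ≤ t → F t 0 = 0) ∧
  ∃ μ : ℝ, 0 < μ ∧ ∃ ρ : ℝ, 0 < ρ ∧ ∃ K : ℝ, 1 ≤ K ∧
    ∀ t₀ T : ℝ, 0 ≤ t₀ → t₀ ≤ T → ∀ e : ℝ → Vec n,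
      SolvesOn (Set.Icc t₀ T) e (fun t => F t (e t)) →
      ‖e t₀‖ ≤ ρ →
      ∀ t ∈ Set.Icc t₀ T, ‖e t‖ ≤ K * Real.exp (-μ * (t - t₀)) * ‖e t₀‖

/-! ### Continuous QR decomposition and Bohl exponents -/

/-- The skew-symmetric matrix whose entries strictly below the diagonal are those of `M`. -/
def skewOfLower {k : ℕ} (M : Mat k k) : Mat k k :=
  Matrix.of fun i j => if j < i then M i j else if i < j then -M j i else 0

/-- `S = skew(Qᵀ A Q)`, i.e. `sᵢⱼ = qᵢᵀ A qⱼ` for `i > j` with `qᵢ` the columns of `Q`. -/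
def qrSkew {n k : ℕ} (A : Mat n n) (Q : Mat n k) : Mat k k := skewOfLower (Qᵀ * A * Q)

/-- `B = Qᵀ A Q - S`. -/
def qrB {n k : ℕ} (A : Mat n n) (Q : Mat n k) : Mat k k := Qᵀ * A * Q - qrSkew A Q

/-- `Q` is the orthogonal factor of a continuous QR decomposition of a fundamental solution of
`ẋ = A(t) x`: `Q(0)` is orthogonal and `Q̇ = Q S`. -/
structure IsFullQR {n : ℕ} (A Q : ℝ → Mat n n) : Prop where
  init : (Q 0)ᵀ * Q 0 = 1
  ode : MatSolves Q (fun t => Q t * qrSkew (A t) (Q t))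

/-- The upper Bohl exponent of `b`: the upper limit of the mean of `b` over `[t₀, t₀ + s]` as
`t₀ → ∞` and `s → ∞`. -/
def upperBohl (b : ℝ → ℝ) : ℝ :=
  Filter.limsup (fun q : ℝ × ℝ => (1 / q.2) * ∫ τ in q.1..(q.1 + q.2), b τ)
    (Filter.atTop ×ˢ Filter.atTop)

/-- The first integer `0 ≤ j ≤ n` such that the upper Bohl exponents of `qᵢᵀ A qᵢ` are negative
for `i = j + 1, …, n` (columns counted from `1`). -/
def jStar {n : ℕ} (A Q : ℝ → Mat n n) : ℕ :=
  sInf {j : ℕ | j ≤ n ∧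
    ∀ i : Fin n, j ≤ (i : ℕ) → upperBohl (fun t => ((Q t)ᵀ * A t * Q t) i i) < 0}

/-! ### The extended subspace observer -/

/-- The Jacobian matrix `∂f/∂x` at `(x, u)`. -/
def jacobian {n m : ℕ} (f : Vec n → Vec m → Vec n) (x : Vec n) (u : Vec m) : Mat n n :=
  Matrix.of fun i j => (fderiv ℝ (fun z => f z u) x (EuclideanSpace.single j 1)) i

/-- The Jacobian `A(t)` along the estimate `x̂` and the input `u`. -/
def jacobianAlong {n m : ℕ} (f : Vec n → Vec m → Vec n) (xhat : ℝ → Vec n) (u : ℝ → Vec m)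
    (t : ℝ) : Mat n n :=
  jacobian f (xhat t) (u t)

/-- The remainder `η(e, x, u)` of the Taylor series of `f` at `x`, truncated after the linear
term. -/
def taylorRemainder {n m : ℕ} (f : Vec n → Vec m → Vec n) (e x : Vec n) (u : Vec m) : Vec n :=
  f (x + e) u - f x u - matVec (jacobian f x u) e

/-- The gain `L = Q̄ P₁ C̄ᵀ` with `C̄ = C Q̄`. -/
def observerGain {n k p : ℕ} (C : Mat p n) (Qbar : Mat n k) (P₁ : Mat k k) : Mat n p :=
  Qbar * P₁ * (C * Qbar)ᵀ

/-- `x` is a trajectory of the plant `ẋ = f(x, u)` on `[0, ∞)`. -/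
def IsPlantTrajectory {n m : ℕ} (f : Vec n → Vec m → Vec n) (u : ℝ → Vec m)
    (x : ℝ → Vec n) : Prop :=
  SolvesOn (Set.Ici 0) x (fun t => f (x t) (u t))

/-- `(x̂, Q̄, P₁)` is a trajectory on `[0, ∞)` of the extended subspace observer with weight `G₁`,
for the input `u` and the measured output `y`. -/
structure IsExtendedSubspaceObserver {n m p k : ℕ} (f : Vec n → Vec m → Vec n)
    (C : ℝ → Mat p n) (u : ℝ → Vec m) (y : ℝ → Vec p) (G₁ : ℝ → Mat k k)
    (xhat : ℝ → Vec n) (Qbar : ℝ → Mat n k) (P₁ : ℝ → Mat k k) : Prop where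
  /-- `g₁ I ⪯ G₁(t) ⪯ g₂ I` -/
  weight : ∃ g₁ g₂ : ℝ, 0 < g₁ ∧ g₁ ≤ g₂ ∧ ∀ t : ℝ, 0 ≤ t →
    LoewnerLE (g₁ • (1 : Mat k k)) (G₁ t) ∧ LoewnerLE (G₁ t) (g₂ • (1 : Mat k k))
  /-- `d/dt x̂ = f(x̂, u) + L (y - C x̂)` -/
  estimate : SolvesOn (Set.Ici 0) xhat (fun t =>
    f (xhat t) (u t) +
      matVec (observerGain (C t) (Qbar t) (P₁ t)) (y t - matVec (C t) (xhat t)))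
  /-- `Ṗ₁ = B₁ P₁ + P₁ B₁ᵀ - P₁ C̄ᵀ C̄ P₁ + G₁` -/
  riccati : MatSolves P₁ (fun t =>
    qrB (jacobianAlong f xhat u t) (Qbar t) * P₁ t +
      P₁ t * (qrB (jacobianAlong f xhat u t) (Qbar t))ᵀ -
      P₁ t * (C t * Qbar t)ᵀ * (C t * Qbar t) * P₁ t + G₁ t)
  riccati_init : (P₁ 0).PosDef
  /-- `d/dt Q̄ = (I - Q̄ Q̄ᵀ) A Q̄ + Q̄ S₁` -/
  qr : MatSolves Qbar (fun t =>
    (1 - Qbar t * (Qbar t)ᵀ) * jacobianAlong f xhat u t * Qbar t +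
      Qbar t * qrSkew (jacobianAlong f xhat u t) (Qbar t))
  qr_init : (Qbar 0)ᵀ * Qbar 0 = 1

/-- The right-hand side `(A(t) - L(t) C(t)) e + η(e, x̂(t), u(t))` of the error dynamics. -/
def errorField {n m p k : ℕ} (f : Vec n → Vec m → Vec n) (C : ℝ → Mat p n) (u : ℝ → Vec m)
    (xhat : ℝ → Vec n) (Qbar : ℝ → Mat n k) (P₁ : ℝ → Mat k k) (t : ℝ) (e : Vec n) : Vec n :=
  matVec (jacobianAlong f xhat u t - observerGain (C t) (Qbar t) (P₁ t) * C t) e +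
    taylorRemainder f e (xhat t) (u t)

end

/-! ### Locally finite exceptional sets and monotonicity -/

/-! In the coordinates `z = Qᵀ e` the linear part of the error dynamics is block triangular. The
range of the gain lies in the span of `Q̄`, so output injection never reaches the last `l = n - k`
coordinates `z₂`. Their matrix `U` is upper triangular with diagonal entries `qᵢᵀ A qᵢ`, whose upper
Bohl exponents are negative because `j* ≤ k`. The first block is `ż₁ = (B₁ - P₁ C̄ᵀ C̄) z₁ + F z₂`,
a Kalman-Bucy error equation driven by `z₂`.

Each block has a quadratic Lyapunov function. For `z₁` it is `z₁ᵀ P₁⁻¹ z₁ = yᵀ P₁ y` with `P₁ y =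
z₁`; by the Riccati equation its derivative contains `-yᵀ G₁ y` (`riccati_derivative_eq`). For a
scalar equation `ż = b z` with negative upper Bohl exponent, `w(t) = ∫_t^∞ exp (2 ∫_t^s b) ds` is
bounded above and away from zero, and `(w z²)˙ = -z²` (`exists_weight_of_upperBohl_neg`). The sum of
`yᵀ P₁ y` and the terms `γ^(i+1) wᵢ z₂ᵢ²` handles the couplings: each coordinate is disturbed only
by later ones, so a large `γ` lets the decay of the later coordinates absorb them
(`weighted_triangular_sum_le`).

Since `Q` is orthogonal (`IsFullQR.orthogonal`), the total is comparable with `‖e‖²`, and its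
derivative is at most `-δ ‖e‖² + σ ‖e‖ ‖η‖` (`lyapunov_derivative_le`). The remainder `η` is
quadratic in `e`, so half of the decay survives near the origin, and
`locallyUniformlyExpStable_of_lyapunov` concludes. -/

lemma LocallyFiniteTimes.union {D₁ D₂ : Set ℝ} (h₁ : LocallyFiniteTimes D₁)
    (h₂ : LocallyFiniteTimes D₂) : LocallyFiniteTimes (D₁ ∪ D₂) := fun T => by
  rw [Set.union_inter_distrib_right]
  exact (h₁ T).union (h₂ T)

lemma LocallyFiniteTimes.iUnion {ι : Type*} [Finite ι] {D : ι → Set ℝ}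
    (h : ∀ i, LocallyFiniteTimes (D i)) : LocallyFiniteTimes (⋃ i, D i) := fun T => by
  rw [Set.iUnion_inter]
  exact Set.finite_iUnion fun i => h i T

lemma LocallyFiniteTimes.countable_inter_Ici {D : Set ℝ} (h : LocallyFiniteTimes D) :
    (D ∩ Set.Ici 0).Countable := by
  refine (Set.countable_iUnion fun N : ℕ => (h N).countable).mono ?_
  rintro t ⟨htD, ht⟩
  obtain ⟨N, hN⟩ := exists_nat_ge t
  exact Set.mem_iUnion.2 ⟨N, htD, ht, hN⟩

/-- A continuous function whose derivative is nonpositive off a finite set does not increase. -/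
lemma le_of_deriv_nonpos_off_finite {D : Set ℝ} (hD : D.Finite) :
    ∀ {a b : ℝ} {g : ℝ → ℝ}, a ≤ b → ContinuousOn g (Set.Icc a b) →
      (∀ t ∈ Set.Ioo a b, t ∉ D → ∃ g', HasDerivWithinAt g g' (Set.Icc a b) t ∧ g' ≤ 0) →
      g b ≤ g a := by
  induction D, hD using Set.Finite.induction_on with
  | empty =>
    intro a b g hab hc hd
    refine antitoneOn_of_deriv_nonpos (convex_Icc a b) hc ?_ ?_ (Set.left_mem_Icc.2 hab)
      (Set.right_mem_Icc.2 hab) hab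
    · intro t ht
      rw [interior_Icc] at ht ⊢
      obtain ⟨g', hg, -⟩ := hd t ht (Set.notMem_empty t)
      exact (hg.hasDerivAt (Icc_mem_nhds ht.1 ht.2)).differentiableAt.differentiableWithinAt
    · intro t ht
      rw [interior_Icc] at ht
      obtain ⟨g', hg, hle⟩ := hd t ht (Set.notMem_empty t)
      rw [(hg.hasDerivAt (Icc_mem_nhds ht.1 ht.2)).deriv]
      exact hle
  | @insert c D _ _ ih =>
    intro a b g hab hc hd
    -- The derivative is required on the open interval only. Cutting at `c` therefore turns the
    -- exceptional time into an end point of both halves, where continuity suffices.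
    by_cases hcm : c ∈ Set.Ioo a b
    · have hl : Set.Icc a c ⊆ Set.Icc a b := Set.Icc_subset_Icc_right hcm.2.le
      have hr : Set.Icc c b ⊆ Set.Icc a b := Set.Icc_subset_Icc_left hcm.1.le
      refine (ih hcm.2.le (hc.mono hr) fun t ht htD => ?_).trans
        (ih hcm.1.le (hc.mono hl) fun t ht htD => ?_)
      · obtain ⟨g', hg, hle⟩ := hd t ⟨hcm.1.trans ht.1, ht.2⟩
          (by rintro (h | h); exacts [ht.1.ne' h, htD h])
        exact ⟨g', hg.mono hr, hle⟩
      · obtain ⟨g', hg, hle⟩ := hd t ⟨ht.1, ht.2.trans hcm.2⟩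
          (by rintro (h | h); exacts [ht.2.ne h, htD h])
        exact ⟨g', hg.mono hl, hle⟩
    · refine ih hab hc fun t ht htD => hd t ht ?_
      rintro (h | h)
      exacts [hcm (h ▸ ht), htD h]

lemma le_of_deriv_nonpos_off_locallyFinite {D : Set ℝ} (hD : LocallyFiniteTimes D) {a b : ℝ}
    {g : ℝ → ℝ} (ha : 0 ≤ a) (hab : a ≤ b) (hc : ContinuousOn g (Set.Icc a b))
    (hd : ∀ t ∈ Set.Icc a b, t ∉ D → ∃ g', HasDerivWithinAt g g' (Set.Icc a b) t ∧ g' ≤ 0) :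
    g b ≤ g a :=
  le_of_deriv_nonpos_off_finite (hD b) hab hc fun t ht htD =>
    hd t (Set.Ioo_subset_Icc_self ht) fun h => htD ⟨h, ha.trans ht.1.le, ht.2.le⟩

/-! ### A Lyapunov criterion -/

/-- If every solution carries a function `v`, comparable with `‖e‖²`, that decays as long as
`‖e‖ ≤ r`, then the origin is locally uniformly exponentially stable. -/
theorem locallyUniformlyExpStable_of_lyapunov {n : ℕ} {F : ℝ → Vec n → Vec n}
    (h0 : ∀ t : ℝ, 0 ≤ t → F t 0 = 0) {m M δ r : ℝ} (hm : 0 < m) (hM : 0 < M) (hδ : 0 < δ)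
    (hr : 0 < r)
    (h : ∀ t₀ T : ℝ, 0 ≤ t₀ → t₀ ≤ T → ∀ e : ℝ → Vec n,
      SolvesOn (Set.Icc t₀ T) e (fun t => F t (e t)) →
      ∃ v : ℝ → ℝ, ContinuousOn v (Set.Icc t₀ T) ∧
        (∀ t ∈ Set.Icc t₀ T, m * ‖e t‖ ^ 2 ≤ v t ∧ v t ≤ M * ‖e t‖ ^ 2) ∧
        ∃ D : Set ℝ, LocallyFiniteTimes D ∧ ∀ t ∈ Set.Icc t₀ T, t ∉ D →
          ‖e t‖ ≤ r → ∃ v', HasDerivWithinAt v v' (Set.Icc t₀ T) t ∧ v' ≤ -δ * ‖e t‖ ^ 2) :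
    LocallyUniformlyExpStable F := by
  set K : ℝ := Real.sqrt (M / m) + 1 with hK
  have hK1 : 1 ≤ K := by rw [hK]; linarith [Real.sqrt_nonneg (M / m)]
  have hK0 : 0 < K := by linarith
  have hMK : M ≤ m * K ^ 2 := by
    have h1 : Real.sqrt (M / m) ^ 2 = M / m := Real.sq_sqrt (by positivity)
    have h2 : M / m ≤ K ^ 2 := by
      rw [← h1]; exact pow_le_pow_left₀ (Real.sqrt_nonneg _) (by rw [hK]; linarith) 2
    have := (div_le_iff₀ hm).1 h2
    linarith
  -- `v` decays at rate `δ / M`, and passing from `‖e‖²` to `‖e‖` halves the rate. The radius `r /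
  -- (2 * K)` keeps the overshoot `K ‖e t₀‖` strictly below `r`.
  refine ⟨h0, δ / (2 * M), by positivity, r / (2 * K), by positivity, K, hK1, ?_⟩
  intro t₀ T ht₀ hT e he hinit
  obtain ⟨v, hvc, hvb, D, hD, hvd⟩ := h t₀ T ht₀ hT e he
  have hKe : K * ‖e t₀‖ < r := by
    have : K * ‖e t₀‖ ≤ K * (r / (2 * K)) := mul_le_mul_of_nonneg_left hinit hK0.le
    have h2 : K * (r / (2 * K)) = r / 2 := by field_simp
    linarith
  have key : ∀ t ∈ Set.Icc t₀ T, (∀ s ∈ Set.Icc t₀ t, ‖e s‖ ≤ r) →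
      ‖e t‖ ≤ K * Real.exp (-(δ / (2 * M)) * (t - t₀)) * ‖e t₀‖ := by
    intro t ht hs
    have hsub : Set.Icc t₀ t ⊆ Set.Icc t₀ T := Set.Icc_subset_Icc_right ht.2
    have hdec := le_of_deriv_nonpos_off_locallyFinite (a := t₀) (b := t)
      (g := fun s => v s * Real.exp (δ / M * (s - t₀))) hD ht₀ ht.1
      ((hvc.mono hsub).mul (by fun_prop)) (by
        intro s hsm hsD
        obtain ⟨v', hv', hle⟩ := hvd s (hsub hsm) hsD (hs s hsm)
        have hexp : HasDerivWithinAt (fun s => Real.exp (δ / M * (s - t₀)))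
            (Real.exp (δ / M * (s - t₀)) * (δ / M * 1)) (Set.Icc t₀ t) s :=
          ((((hasDerivAt_id s).sub_const t₀).const_mul (δ / M)).exp).hasDerivWithinAt
        refine ⟨_, (hv'.mono hsub).mul hexp, ?_⟩
        have hE := Real.exp_pos (δ / M * (s - t₀))
        have h3 : δ / M * v s ≤ δ * ‖e s‖ ^ 2 := by
          rw [div_mul_eq_mul_div, div_le_iff₀ hM]
          nlinarith [(hvb s (hsub hsm)).2]
        have : v' * Real.exp (δ / M * (s - t₀)) + v s * (Real.exp (δ / M * (s - t₀)) * (δ / M * 1))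
          = Real.exp (δ / M * (s - t₀)) * (v' + δ / M * v s) := by ring
        rw [this]
        exact mul_nonpos_of_nonneg_of_nonpos hE.le (by linarith))
    simp only [sub_self, mul_zero, Real.exp_zero, mul_one] at hdec
    have hE := Real.exp_pos (δ / M * (t - t₀))
    have h1 : (‖e t‖ * Real.exp (δ / (2 * M) * (t - t₀))) ^ 2 ≤ (K * ‖e t₀‖) ^ 2 := by
      have h2 : Real.exp (δ / (2 * M) * (t - t₀)) ^ 2 = Real.exp (δ / M * (t - t₀)) := by
        rw [← Real.exp_nat_mul]; congr 1; push_cast; field_simp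
      rw [mul_pow, mul_pow, h2]
      have h3 := mul_le_mul_of_nonneg_right (hvb t ht).1 hE.le
      have h4 := (hvb t₀ (Set.left_mem_Icc.2 hT)).2
      have h5 := mul_le_mul_of_nonneg_right hMK (sq_nonneg ‖e t₀‖)
      have h6 : m * (‖e t‖ ^ 2 * Real.exp (δ / M * (t - t₀))) ≤ m * (K ^ 2 * ‖e t₀‖ ^ 2) := by
        linarith
      exact le_of_mul_le_mul_left h6 hm
    have h2 := abs_le_of_sq_le_sq h1 (by positivity)
    have h3 := (le_abs_self _).trans h2
    have h4 : Real.exp (-(δ / (2 * M)) * (t - t₀)) * Real.exp (δ / (2 * M) * (t - t₀)) = 1 := by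
      rw [← Real.exp_add]; simp
    have h5 := mul_le_mul_of_nonneg_right h3 (Real.exp_pos (-(δ / (2 * M)) * (t - t₀))).le
    calc ‖e t‖ = ‖e t‖ * (Real.exp (-(δ / (2 * M)) * (t - t₀)) *
          Real.exp (δ / (2 * M) * (t - t₀))) := by rw [h4, mul_one]
      _ = ‖e t‖ * Real.exp (δ / (2 * M) * (t - t₀)) *
          Real.exp (-(δ / (2 * M)) * (t - t₀)) := by ring
      _ ≤ _ := h5
      _ = _ := by ring
  have hsmall : ∀ t ∈ Set.Icc t₀ T, ‖e t‖ < r := by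
    by_contra! hcon
    obtain ⟨t', ht', htr⟩ := hcon
    have hcl : IsCompact (Set.Icc t₀ T ∩ (fun t => ‖e t‖) ⁻¹' Set.Ici r) :=
      isCompact_Icc.of_isClosed_subset
        (he.1.norm.preimage_isClosed_of_isClosed isClosed_Icc isClosed_Ici) Set.inter_subset_left
    -- At the first time `t₁` with `‖e‖ ≥ r` the conditional estimate `key` is still valid, and it
    -- gives `‖e t₁‖ ≤ K ‖e t₀‖ < r`, a contradiction.
    obtain ⟨t₁, ht₁, hleast⟩ := hcl.exists_isLeast ⟨t', ht', htr⟩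
    have hbefore : ∀ s ∈ Set.Icc t₀ T, s < t₁ → ‖e s‖ < r := fun s hs hlt => by
      by_contra! hge
      exact absurd (hleast ⟨hs, hge⟩) (not_le.2 hlt)
    have hpos : t₀ < t₁ := lt_of_le_of_ne ht₁.1.1 (by
      rintro rfl
      have h1 : r ≤ ‖e t₀‖ := ht₁.2
      nlinarith [norm_nonneg (e t₀)])
    have hle : ‖e t₁‖ ≤ r := by
      have hcw : ContinuousWithinAt (fun t => ‖e t‖) (Set.Ico t₀ t₁) t₁ :=
        (he.1.norm t₁ ht₁.1).mono fun s hs => ⟨hs.1, hs.2.le.trans ht₁.1.2⟩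
      refine hcw.closure_le ?_ continuousWithinAt_const fun s hs =>
        (hbefore s ⟨hs.1, hs.2.le.trans ht₁.1.2⟩ hs.2).le
      rw [closure_Ico hpos.ne]
      exact Set.right_mem_Icc.2 hpos.le
    have hk := key t₁ ht₁.1 fun s hs => by
      rcases hs.2.lt_or_eq with hlt | rfl
      exacts [(hbefore s ⟨hs.1, hs.2.trans ht₁.1.2⟩ hlt).le, hle]
    have hexp : Real.exp (-(δ / (2 * M)) * (t₁ - t₀)) ≤ 1 := by
      rw [Real.exp_le_one_iff]
      have : 0 ≤ δ / (2 * M) * (t₁ - t₀) := mul_nonneg (by positivity) (by linarith)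
      linarith
    have : r ≤ ‖e t₁‖ := ht₁.2
    have h9 : K * Real.exp (-(δ / (2 * M)) * (t₁ - t₀)) * ‖e t₀‖ ≤ K * 1 * ‖e t₀‖ := by gcongr
    linarith
  exact fun t ht => key t ht fun s hs => (hsmall s ⟨hs.1, hs.2.trans ht.2⟩).le

/-! ### Weights from negative Bohl exponents -/

open MeasureTheory in
/-- If `φ` decreases linearly up to a constant, then `ẇ = -1 - 2 φ̇ w` has a solution that is
bounded and bounded away from zero, namely `w(t) = ∫_t^∞ exp (2 (φ(s) - φ(t))) ds`. -/
lemma exists_weight_of_decay {φ : ℝ → ℝ} (hφ : Continuous φ) {a c M : ℝ} (ha : 0 < a)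
    (hc : 0 < c) (hlip : ∀ t s, 0 ≤ t → t ≤ s → φ t - φ s ≤ a * (s - t))
    (hdec : ∀ t s, 0 ≤ t → t ≤ s → φ s - φ t ≤ M - c * (s - t)) :
    ∃ w : ℝ → ℝ, Continuous w ∧
      (∃ w₁ w₂ : ℝ, 0 < w₁ ∧ ∀ t, 0 ≤ t → w₁ ≤ w t ∧ w t ≤ w₂) ∧
      ∀ (t b : ℝ) (S : Set ℝ), HasDerivWithinAt φ b S t →
        HasDerivWithinAt w (-1 - 2 * b * w t) S t := by
  have hE : Continuous fun s => Real.exp (2 * φ s) := by fun_prop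
  have hint : ∀ t, 0 ≤ t → IntegrableOn (fun s => Real.exp (2 * φ s)) (Set.Ioi t) := by
    intro t ht
    refine Integrable.mono' (((integrableOn_exp_mul_Ioi (a := -(2 * c)) (by linarith) t)).const_mul
      (Real.exp (2 * φ t + 2 * M + 2 * c * t))) hE.aestronglyMeasurable ?_
    refine (ae_restrict_mem measurableSet_Ioi).mono fun s hs => ?_
    rw [Real.norm_eq_abs, abs_of_pos (Real.exp_pos _), ← Real.exp_add]
    have := hdec t s ht (le_of_lt hs)
    exact Real.exp_le_exp.2 (by linarith)
  have hsplit : ∀ t, 0 ≤ t → (∫ s in Set.Ioi 0, Real.exp (2 * φ s)) -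
      ∫ s in (0 : ℝ)..t, Real.exp (2 * φ s) = ∫ s in Set.Ioi t, Real.exp (2 * φ s) := by
    intro t ht
    rw [← intervalIntegral.integral_Ioi_sub_Ioi (hint 0 le_rfl) ht]
    ring
  have hprim : ∀ t, HasDerivAt (fun t => ∫ s in (0 : ℝ)..t, Real.exp (2 * φ s))
      (Real.exp (2 * φ t)) t := fun t => intervalIntegral.integral_hasDerivAt_right
        (hE.intervalIntegrable _ _) hE.stronglyMeasurable.stronglyMeasurableAtFilter hE.continuousAt
  -- Writing the tail integral as a constant minus a primitive makes `w` continuous and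
  -- differentiable on the whole line; `hsplit` recovers the tail for `t ≥ 0`. Comparing the
  -- integrand with `exp (-2a(s - t))` and `exp (2M - 2c(s - t))` yields the two bounds.
  refine ⟨fun t => Real.exp (-(2 * φ t)) * ((∫ s in Set.Ioi 0, Real.exp (2 * φ s)) -
      ∫ s in (0 : ℝ)..t, Real.exp (2 * φ s)), ?_,
    ⟨1 / (2 * a), Real.exp (2 * M) / (2 * c), by positivity, ?_⟩, ?_⟩
  · have : Continuous fun t => ∫ s in (0 : ℝ)..t, Real.exp (2 * φ s) :=
      continuous_iff_continuousAt.2 fun t => (hprim t).continuousAt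
    fun_prop
  · intro t ht
    simp only [hsplit t ht]
    constructor
    · have h1 : ∫ s in Set.Ioi t, Real.exp (2 * φ t + 2 * a * t) * Real.exp (-(2 * a) * s) ≤
          ∫ s in Set.Ioi t, Real.exp (2 * φ s) := by
        refine setIntegral_mono_on
          ((integrableOn_exp_mul_Ioi (a := -(2 * a)) (by linarith) t).const_mul _) (hint t ht)
          measurableSet_Ioi fun s hs => ?_
        rw [← Real.exp_add]
        have := hlip t s ht (le_of_lt hs)
        exact Real.exp_le_exp.2 (by linarith)
      rw [integral_const_mul, integral_exp_mul_Ioi (by linarith)] at h1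
      refine le_trans (le_of_eq ?_) (mul_le_mul_of_nonneg_left h1 (Real.exp_pos _).le)
      rw [neg_div_neg_eq, mul_div_assoc', mul_div_assoc', ← Real.exp_add, ← Real.exp_add]
      congr 1
      rw [eq_comm, Real.exp_eq_one_iff]; ring
    · have h1 : ∫ s in Set.Ioi t, Real.exp (2 * φ s) ≤
          ∫ s in Set.Ioi t, Real.exp (2 * φ t + 2 * M + 2 * c * t) * Real.exp (-(2 * c) * s) := by
        refine setIntegral_mono_on (hint t ht)
          ((integrableOn_exp_mul_Ioi (a := -(2 * c)) (by linarith) t).const_mul _)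
          measurableSet_Ioi fun s hs => ?_
        rw [← Real.exp_add]
        have := hdec t s ht (le_of_lt hs)
        exact Real.exp_le_exp.2 (by linarith)
      rw [integral_const_mul, integral_exp_mul_Ioi (by linarith)] at h1
      refine (mul_le_mul_of_nonneg_left h1 (Real.exp_pos _).le).trans (le_of_eq ?_)
      rw [neg_div_neg_eq, mul_div_assoc', mul_div_assoc', ← Real.exp_add, ← Real.exp_add]
      congr 2
      ring
  · intro t b S hb
    have h1 : HasDerivWithinAt (fun t => Real.exp (-(2 * φ t)))
        (Real.exp (-(2 * φ t)) * (-(2 * b))) S t := ((hb.const_mul 2).neg).exp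
    have h2 := (hprim t).hasDerivWithinAt (s := S)
    refine (h1.mul (h2.const_sub (∫ s in Set.Ioi 0, Real.exp (2 * φ s)))).congr_deriv ?_
    have h3 : Real.exp (-(2 * φ t)) * Real.exp (2 * φ t) = 1 := by
      rw [← Real.exp_add]; simp
    linear_combination -h3

open MeasureTheory in
/-- A primitive on `[0, ∞)` of a bounded function that is continuous off a locally finite set. -/
lemma exists_primitive {b : ℝ → ℝ} {a : ℝ} (hb : ∀ t, 0 ≤ t → |b t| ≤ a) {D : Set ℝ}
    (hD : LocallyFiniteTimes D)
    (hcont : ∀ t, 0 ≤ t → t ∉ D → ContinuousWithinAt b (Set.Ici 0) t) :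
    ∃ φ : ℝ → ℝ, Continuous φ ∧
      (∀ t s, 0 ≤ t → t ≤ s → φ s - φ t = ∫ τ in t..s, b τ) ∧
      ∀ t, 0 ≤ t → t ∉ D → HasDerivAt φ (b t) t := by
  -- The constant extension to negative times makes the derivative of the primitive two-sided even
  -- at `t = 0`.
  set g : ℝ → ℝ := fun t => b (max t 0) with hg
  have hgb : ∀ t, ‖g t‖ ≤ a := fun t => hb _ (le_max_right _ _)
  have hgc : ∀ t, t ∉ D ∩ Set.Ici 0 → t ≠ 0 → ContinuousAt g t := by
    intro t ht ht0
    rcases lt_or_gt_of_ne ht0 with h | h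
    · have : g =ᶠ[nhds t] fun _ => b 0 := by
        filter_upwards [Iio_mem_nhds h] with s hs
        simp only [hg]; rw [max_eq_right (le_of_lt hs)]
      exact continuousAt_const.congr this.symm
    · have h1 := hcont t h.le fun hD => ht ⟨hD, h.le⟩
      have h2 : ContinuousAt b t := h1.continuousAt (Ici_mem_nhds h)
      refine h2.congr ?_
      filter_upwards [Ioi_mem_nhds h] with s hs
      simp only [hg]; rw [max_eq_left (le_of_lt hs)]
  have hcount : (insert 0 (D ∩ Set.Ici 0)).Countable := hD.countable_inter_Ici.insert 0
  have hgm : AEStronglyMeasurable g volume := by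
    have h1 : ContinuousOn g (insert 0 (D ∩ Set.Ici 0))ᶜ := fun t ht =>
      (hgc t (fun h => ht (Or.inr h)) (fun h => ht (Or.inl h))).continuousWithinAt
    have h2 := h1.aestronglyMeasurable (μ := volume) hcount.measurableSet.compl
    rwa [Measure.restrict_eq_self_of_ae_mem] at h2
    exact compl_mem_ae_iff.2 (hcount.measure_zero volume)
  have hgi : ∀ t s, IntervalIntegrable g volume t s := fun t s => by
    refine (intervalIntegrable_const (c := a)).mono_fun' hgm.restrict ?_
    exact Filter.Eventually.of_forall hgb
  have hcontφ : Continuous fun t => ∫ s in (0 : ℝ)..t, g s :=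
    intervalIntegral.continuous_primitive hgi 0
  refine ⟨fun t => ∫ s in (0 : ℝ)..t, g s, hcontφ, ?_, ?_⟩
  · intro t s ht hts
    rw [intervalIntegral.integral_interval_sub_left (hgi _ _) (hgi _ _)]
    refine intervalIntegral.integral_congr fun τ hτ => ?_
    rw [Set.uIcc_of_le hts] at hτ
    simp only [hg]; rw [max_eq_left (ht.trans hτ.1)]
  · intro t ht htD
    have hgt : g t = b t := by simp only [hg]; rw [max_eq_left ht]
    rw [← hgt]
    refine intervalIntegral.integral_hasDerivAt_right (hgi _ _)
      ⟨Set.univ, Filter.univ_mem, hgm.restrict⟩ ?_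
    have h1 : ContinuousWithinAt b (Set.Ici 0) (max t 0) := by
      rw [max_eq_left ht]; exact hcont t ht htD
    have h2 : ContinuousWithinAt (fun t : ℝ => max t 0) Set.univ t :=
      (by fun_prop : Continuous fun t : ℝ => max t 0).continuousWithinAt
    exact continuousWithinAt_univ _ _ |>.1 (ContinuousWithinAt.comp (f := fun t : ℝ => max t 0) (x := t) h1 h2
      fun s _ => le_max_right s 0)

/-- A negative upper Bohl exponent gives linear decay of the integral over all of `[0, ∞)`. -/
lemma exists_decay_of_upperBohl_neg {b : ℝ → ℝ} {a : ℝ} (ha : 0 < a)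
    (hb : ∀ t, 0 ≤ t → |b t| ≤ a) {φ : ℝ → ℝ}
    (hφ : ∀ t s, 0 ≤ t → t ≤ s → φ s - φ t = ∫ τ in t..s, b τ) (hneg : upperBohl b < 0) :
    ∃ c M : ℝ, 0 < c ∧ ∀ t s, 0 ≤ t → t ≤ s → φ s - φ t ≤ M - c * (s - t) := by
  have hint : ∀ t s, 0 ≤ t → t ≤ s → |∫ τ in t..s, b τ| ≤ a * (s - t) := by
    intro t s ht hts
    have := intervalIntegral.norm_integral_le_of_norm_le_const (a := t) (b := s) (f := b) (C := a)
      (fun τ hτ => by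
        rw [Set.uIoc_of_le hts] at hτ
        exact hb τ (ht.trans hτ.1.le))
    rwa [abs_of_nonneg (sub_nonneg.2 hts)] at this
  obtain ⟨r, hr1, hr2⟩ := exists_between hneg
  -- A real `limsup` bounds its values eventually only if these are bounded above; here the means
  -- are at most `a`.
  have hev := Filter.eventually_lt_of_limsup_lt hr1 (by
    refine ⟨a, ?_⟩
    rw [Filter.eventually_map]
    filter_upwards [Filter.prod_mem_prod (Filter.eventually_ge_atTop (0 : ℝ))
      (Filter.eventually_gt_atTop (0 : ℝ))] with q hq
    have h1 : (0 : ℝ) ≤ q.1 := hq.1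
    have h2 : (0 : ℝ) < q.2 := hq.2
    have h3 := (le_abs_self _).trans (hint q.1 (q.1 + q.2) h1 (by linarith))
    rw [one_div, inv_mul_le_iff₀ h2]
    linarith)
  obtain ⟨p, hp, p', hp', hpp⟩ := Filter.eventually_prod_iff.1 hev
  obtain ⟨T, hT⟩ := Filter.eventually_atTop.1 hp
  obtain ⟨σ, hσ⟩ := Filter.eventually_atTop.1 hp'
  set T₁ := max T 0
  set s₁ := max σ 1
  have hT0 : 0 ≤ T₁ := le_max_right _ _
  have hs1 : 1 ≤ s₁ := le_max_right _ _
  -- The exponent controls only windows that start after `T₁` and last at least `s₁`. The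
  -- uncontrolled time is at most `T₁ + s₁`; per unit it costs growth `a` and a missed decay `-r`.
  refine ⟨-r, (a + -r) * (T₁ + s₁), by linarith, fun t s ht hts => ?_⟩
  have hr0 : 0 < -r := by linarith
  rcases le_total (max t T₁ + s₁) s with h | h
  · have ht1 : t ≤ max t T₁ := le_max_left _ _
    have ht2 : max t T₁ ≤ t + T₁ := max_le (by linarith) (by linarith)
    have h1 := (le_abs_self _).trans (hint t (max t T₁) ht ht1)
    have h2 := hpp (hT (max t T₁) ((le_max_left _ _).trans (le_max_right _ _)))
      (hσ (s - max t T₁) ((le_max_left _ _).trans (by linarith)))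
    have hpos : 0 < s - max t T₁ := by linarith
    simp only [add_sub_cancel] at h2
    rw [one_div, inv_mul_lt_iff₀ hpos] at h2
    rw [← hφ _ _ ht ht1] at h1
    rw [← hφ _ _ (ht.trans ht1) (by linarith)] at h2
    have h3 : a * (max t T₁ - t) ≤ a * T₁ := by gcongr; linarith
    have h4 : -r * (max t T₁ - t) ≤ -r * T₁ := by gcongr; linarith
    have h5 : 0 ≤ (a + -r) * s₁ := by positivity
    nlinarith
  · have h1 := (le_abs_self _).trans (hint t s ht hts)
    rw [← hφ _ _ ht hts] at h1
    have h2 : s - t ≤ T₁ + s₁ := by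
      have : max t T₁ ≤ t + T₁ := max_le (by linarith) (by linarith)
      linarith
    have h3 : (a + -r) * (s - t) ≤ (a + -r) * (T₁ + s₁) := by gcongr
    linarith

/-- The Lyapunov weight of a scalar equation `ż = b z` with negative upper Bohl exponent. -/
theorem exists_weight_of_upperBohl_neg {b : ℝ → ℝ} {a : ℝ} (hb : ∀ t, 0 ≤ t → |b t| ≤ a)
    {D : Set ℝ} (hD : LocallyFiniteTimes D)
    (hcont : ∀ t, 0 ≤ t → t ∉ D → ContinuousWithinAt b (Set.Ici 0) t) (hneg : upperBohl b < 0) :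
    ∃ w : ℝ → ℝ, Continuous w ∧
      (∃ w₁ w₂ : ℝ, 0 < w₁ ∧ ∀ t, 0 ≤ t → w₁ ≤ w t ∧ w t ≤ w₂) ∧
      ∀ (t : ℝ) (S : Set ℝ), 0 ≤ t → t ∉ D →
        HasDerivWithinAt w (-1 - 2 * b t * w t) S t := by
  have hb' : ∀ t, 0 ≤ t → |b t| ≤ |a| + 1 := fun t ht =>
    (hb t ht).trans (by linarith [le_abs_self a])
  obtain ⟨φ, hφc, hφ, hφd⟩ := exists_primitive hb' hD hcont
  obtain ⟨c, M, hc, hdec⟩ := exists_decay_of_upperBohl_neg (by positivity) hb' hφ hneg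
  obtain ⟨w, hwc, hwb, hwd⟩ := exists_weight_of_decay hφc (a := |a| + 1) (by positivity) hc
    (fun t s ht hts => by
      have := intervalIntegral.norm_integral_le_of_norm_le_const (a := t) (b := s) (f := b)
        (C := |a| + 1) (fun τ hτ => by
          rw [Set.uIoc_of_le hts] at hτ
          exact hb' τ (ht.trans hτ.1.le))
      rw [abs_of_nonneg (sub_nonneg.2 hts), ← hφ t s ht hts, Real.norm_eq_abs] at this
      linarith [neg_abs_le (φ s - φ t)]) hdec
  exact ⟨w, hwc, hwb, fun t S ht htD => hwd t (b t) S (hφd t ht htD).hasDerivWithinAt⟩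

/-! ### Entrywise calculus of matrix-valued curves -/

section EntrywiseCalculus

variable {α β γ : Type*}

/-- The matrix-valued curve `M` has the derivative `M'` at `t` within `S`, entry by entry. -/
def HasEntryDerivAt (M : ℝ → Matrix α β ℝ) (M' : Matrix α β ℝ) (S : Set ℝ) (t : ℝ) : Prop :=
  ∀ i j, HasDerivWithinAt (fun t => M t i j) (M' i j) S t

/-- The entries of `M` are bounded on `[0, ∞)`. -/
def BoundedEntries (M : ℝ → Matrix α β ℝ) : Prop :=
  ∃ c : ℝ, ∀ t, 0 ≤ t → ∀ i j, |M t i j| ≤ c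

variable {M M₁ M₂ : ℝ → Matrix α β ℝ} {N : ℝ → Matrix β γ ℝ} {M' : Matrix α β ℝ}
  {N' : Matrix β γ ℝ} {S : Set ℝ} {t : ℝ}

lemma HasEntryDerivAt.mono {S' : Set ℝ} (h : HasEntryDerivAt M M' S t) (hS : S' ⊆ S) :
    HasEntryDerivAt M M' S' t := fun i j => (h i j).mono hS

lemma HasEntryDerivAt.transpose (h : HasEntryDerivAt M M' S t) :
    HasEntryDerivAt (fun t => (M t)ᵀ) M'ᵀ S t := fun i j => h j i

lemma HasEntryDerivAt.mul [Fintype β] (hM : HasEntryDerivAt M M' S t)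
    (hN : HasEntryDerivAt N N' S t) :
    HasEntryDerivAt (fun t => M t * N t) (M' * N t + M t * N') S t := by
  intro i j
  simp only [Matrix.mul_apply, Matrix.add_apply, ← Finset.sum_add_distrib]
  exact HasDerivWithinAt.fun_sum fun r _ => (hM i r).mul (hN r j)

lemma HasEntryDerivAt.mulVec [Fintype β] {v : ℝ → β → ℝ} {v' : β → ℝ}
    (hM : HasEntryDerivAt M M' S t) (hv : ∀ j, HasDerivWithinAt (fun t => v t j) (v' j) S t)
    (i : α) : HasDerivWithinAt (fun t => (M t *ᵥ v t) i) ((M' *ᵥ v t + M t *ᵥ v') i) S t := by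
  simp only [Matrix.mulVec, dotProduct, Pi.add_apply, ← Finset.sum_add_distrib]
  exact HasDerivWithinAt.fun_sum fun r _ => (hM i r).mul (hv r)

lemma hasDerivWithinAt_dotProduct [Fintype β] {v w : ℝ → β → ℝ} {v' w' : β → ℝ}
    (hv : ∀ j, HasDerivWithinAt (fun t => v t j) (v' j) S t)
    (hw : ∀ j, HasDerivWithinAt (fun t => w t j) (w' j) S t) :
    HasDerivWithinAt (fun t => v t ⬝ᵥ w t) (v' ⬝ᵥ w t + v t ⬝ᵥ w') S t := by
  simp only [dotProduct, ← Finset.sum_add_distrib]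
  exact HasDerivWithinAt.fun_sum fun r _ => (hv r).mul (hw r)

lemma continuousOn_mulVec [Fintype β] {v : ℝ → β → ℝ}
    (hM : ∀ i j, ContinuousOn (fun t => M t i j) S) (hv : ∀ j, ContinuousOn (fun t => v t j) S)
    (i : α) : ContinuousOn (fun t => (M t *ᵥ v t) i) S := by
  simp only [Matrix.mulVec, dotProduct]
  exact continuousOn_finsetSum _ fun r _ => (hM i r).mul (hv r)

lemma BoundedEntries.transpose (h : BoundedEntries M) : BoundedEntries fun t => (M t)ᵀ :=
  h.imp fun _ hc t ht i j => hc t ht j i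

lemma BoundedEntries.add (h₁ : BoundedEntries M₁) (h₂ : BoundedEntries M₂) :
    BoundedEntries fun t => M₁ t + M₂ t := by
  obtain ⟨c₁, h₁⟩ := h₁
  obtain ⟨c₂, h₂⟩ := h₂
  exact ⟨c₁ + c₂, fun t ht i j => (abs_add_le _ _).trans (add_le_add (h₁ t ht i j) (h₂ t ht i j))⟩

lemma BoundedEntries.sub (h₁ : BoundedEntries M₁) (h₂ : BoundedEntries M₂) :
    BoundedEntries fun t => M₁ t - M₂ t := by
  obtain ⟨c₁, h₁⟩ := h₁
  obtain ⟨c₂, h₂⟩ := h₂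
  exact ⟨c₁ + c₂, fun t ht i j => (abs_sub _ _).trans (add_le_add (h₁ t ht i j) (h₂ t ht i j))⟩

lemma BoundedEntries.mul [Fintype β] (hM : BoundedEntries M) (hN : BoundedEntries N) :
    BoundedEntries fun t => M t * N t := by
  obtain ⟨c₁, h₁⟩ := hM
  obtain ⟨c₂, h₂⟩ := hN
  refine ⟨∑ _r : β, |c₁| * |c₂|, fun t ht i j => ?_⟩
  simp only [Matrix.mul_apply]
  refine (Finset.abs_sum_le_sum_abs _ _).trans (Finset.sum_le_sum fun r _ => ?_)
  rw [abs_mul]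
  exact mul_le_mul ((h₁ t ht i r).trans (le_abs_self _)) ((h₂ t ht r j).trans (le_abs_self _))
    (abs_nonneg _) (abs_nonneg _)

end EntrywiseCalculus

lemma MatSolves.exists_hasEntryDerivAt {n k : ℕ} {M V : ℝ → Mat n k} (h : MatSolves M V) :
    ∃ D : Set ℝ, LocallyFiniteTimes D ∧ ∀ t, 0 ≤ t → t ∉ D →
      HasEntryDerivAt M (V t) (Set.Ici 0) t := by
  choose D hD hd using fun i j => (h i j).2
  refine ⟨⋃ i, ⋃ j, D i j, .iUnion fun i => .iUnion fun j => hD i j, fun t ht htD i j => ?_⟩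
  exact hd i j t ht fun hm => htD (Set.mem_iUnion₂.2 ⟨i, j, hm⟩)

lemma abs_entry_le_norm {n k : ℕ} (M : Mat n k) (i : Fin n) (j : Fin k) : |M i j| ≤ ‖M‖ := by
  have h1 := Matrix.l2_opNorm_mulVec M (EuclideanSpace.single j 1)
  have h2 := PiLp.norm_apply_le ((EuclideanSpace.equiv _ ℝ).symm (M *ᵥ (EuclideanSpace.single j (1 : ℝ)).ofLp)) i
  have h3 := h2.trans h1
  simpa using h3

lemma boundedEntries_of_norm_le {n k : ℕ} {M : ℝ → Mat n k}
    (h : ∃ a : ℝ, ∀ t : ℝ, 0 ≤ t → ‖M t‖ ≤ a) : BoundedEntries M :=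
  h.imp fun _ ha t ht i j => (abs_entry_le_norm _ i j).trans (ha t ht)

/-! ### Differentiability of the solution of a linear equation -/

lemma differentiableWithinAt_matrix_det {ι : Type*} [Fintype ι] [DecidableEq ι] {M : ℝ → Matrix ι ι ℝ}
    {S : Set ℝ} {t : ℝ} (h : ∀ i j, DifferentiableWithinAt ℝ (fun t => M t i j) S t) :
    DifferentiableWithinAt ℝ (fun t => (M t).det) S t := by
  simp only [Matrix.det_apply']
  refine DifferentiableWithinAt.fun_sum fun σ _ => (DifferentiableWithinAt.const_mul ?_ _)
  exact DifferentiableWithinAt.fun_finsetProd fun i _ => h _ _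

/-- Cramer's rule. Only differentiability is needed: the derivative of the inverse drops out of the
Lyapunov computation. -/
lemma differentiableWithinAt_matrix_inv_apply {ι : Type*} [Fintype ι] [DecidableEq ι] {M : ℝ → Matrix ι ι ℝ}
    {S : Set ℝ} {t : ℝ} (h : ∀ i j, DifferentiableWithinAt ℝ (fun t => M t i j) S t)
    (hM : (M t).det ≠ 0) (i j : ι) : DifferentiableWithinAt ℝ (fun t => (M t)⁻¹ i j) S t := by
  simp only [Matrix.inv_def, Ring.inverse_eq_inv', Matrix.smul_apply, smul_eq_mul,
    Matrix.adjugate_apply]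
  refine ((differentiableWithinAt_matrix_det h).inv hM).mul (differentiableWithinAt_matrix_det fun r c => ?_)
  by_cases hr : r = j
  · subst hr
    simp only [Matrix.updateRow_self]
    exact differentiableWithinAt_const _
  · simp only [Matrix.updateRow_ne hr]
    exact h r c

lemma continuousOn_matrix_inv_apply {ι : Type*} [Fintype ι] [DecidableEq ι] {M : ℝ → Matrix ι ι ℝ}
    {S : Set ℝ} (h : ∀ i j, ContinuousOn (fun t => M t i j) S)
    (hM : ∀ t ∈ S, (M t).det ≠ 0) (i j : ι) : ContinuousOn (fun t => (M t)⁻¹ i j) S := by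
  have hM' : ContinuousOn M S := continuousOn_pi.2 fun i => continuousOn_pi.2 fun j => h i j
  simp only [Matrix.inv_def, Ring.inverse_eq_inv', Matrix.smul_apply, smul_eq_mul]
  have h1 : ContinuousOn (fun t => (M t).det) S :=
    (continuous_id.matrix_det).comp_continuousOn hM'
  have h2 : ContinuousOn (fun t => (M t).adjugate i j) S :=
    ((continuous_id.matrix_adjugate).matrix_elem i j).comp_continuousOn hM'
  exact (h1.inv₀ hM).mul h2

/-! ### The continuous QR decomposition -/

lemma skewOfLower_transpose {k : ℕ} (M : Mat k k) : (skewOfLower M)ᵀ = -skewOfLower M := by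
  ext i j
  simp only [skewOfLower, Matrix.transpose_apply, Matrix.of_apply, Matrix.neg_apply]
  rcases lt_trichotomy i j with h | h | h
  · simp [h, h.not_gt]
  · simp [h]
  · simp [h, h.not_gt]

lemma BoundedEntries.skewOfLower {k : ℕ} {M : ℝ → Mat k k} (h : BoundedEntries M) :
    BoundedEntries fun t => skewOfLower (M t) := by
  obtain ⟨c, hc⟩ := h
  refine ⟨c, fun t ht i j => ?_⟩
  have h0 : 0 ≤ c := (abs_nonneg _).trans (hc t ht i j)
  simp only [_root_.skewOfLower, Matrix.of_apply]
  split_ifs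
  · exact hc t ht i j
  · rw [abs_neg]; exact hc t ht j i
  · simpa using h0

/-- `tr (V V̇) = 0` for `V̇ = Sᵀ V + V S` with `V` symmetric and `S` skew-symmetric. -/
lemma trace_mul_lyapunov_eq_zero {ι : Type*} [Fintype ι] {V S : Matrix ι ι ℝ} (hV : Vᵀ = V)
    (hS : Sᵀ = -S) : (Vᵀ * (Sᵀ * V + V * S)).trace = 0 := by
  rw [hV, hS, Matrix.mul_add, Matrix.trace_add, Matrix.neg_mul, Matrix.mul_neg, Matrix.trace_neg,
    Matrix.trace_mul_comm V (S * V), Matrix.mul_assoc, Matrix.trace_mul_comm S (V * V),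
    Matrix.mul_assoc]
  simp

/-- The defect `V = Qᵀ Q - 1` satisfies `V̇ = Sᵀ V + V S` with `S` skew-symmetric. Its squared
Frobenius norm thus has derivative zero, and it vanishes at time `0`. No bound on `S` is needed. -/
lemma IsFullQR.orthogonal {n : ℕ} {A Q : ℝ → Mat n n} (h : IsFullQR A Q) {t : ℝ} (ht : 0 ≤ t) :
    (Q t)ᵀ * Q t = 1 := by
  obtain ⟨D, hD, hd⟩ := h.ode.exists_hasEntryDerivAt
  set V : ℝ → Mat n n := fun t => (Q t)ᵀ * Q t - 1 with hV
  set g : ℝ → ℝ := fun t => ∑ i, ∑ j, V t i j ^ 2 with hg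
  have hQc : ∀ i j, ContinuousOn (fun t => Q t i j) (Set.Ici 0) := fun i j => (h.ode i j).1
  have hVc : ∀ i j, ContinuousOn (fun t => V t i j) (Set.Ici 0) := by
    intro i j
    simp only [hV, Matrix.sub_apply, Matrix.mul_apply, Matrix.transpose_apply]
    exact (continuousOn_finsetSum _ fun r _ => (hQc r i).mul (hQc r j)).sub continuousOn_const
  have hgc : ContinuousOn g (Set.Ici 0) :=
    continuousOn_finsetSum _ fun i _ => continuousOn_finsetSum _ fun j _ => (hVc i j).pow 2
  have hgd : ∀ s, 0 ≤ s → s ∉ D → HasDerivWithinAt g 0 (Set.Ici 0) s := by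
    intro s hs hsD
    set S := qrSkew (A s) (Q s)
    have hS : Sᵀ = -S := skewOfLower_transpose _
    have hQd := hd s hs hsD
    have hVd : HasEntryDerivAt V (Sᵀ * V s + V s * S) (Set.Ici 0) s := by
      intro i j
      have h1 := ((hQd.transpose.mul hQd) i j).sub_const ((1 : Mat n n) i j)
      have h2 : (Q s * S)ᵀ * Q s + (Q s)ᵀ * (Q s * S) = Sᵀ * V s + V s * S := by
        simp only [hV, Matrix.transpose_mul, Matrix.mul_sub, Matrix.sub_mul, Matrix.mul_one,
          Matrix.one_mul, Matrix.mul_assoc]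
        rw [hS]; abel
      exact h1.congr_deriv (congrFun (congrFun h2 i) j)
    have hVs : (V s)ᵀ = V s := by simp [hV, Matrix.transpose_mul]
    have htr := trace_mul_lyapunov_eq_zero hVs hS
    have hgd := HasDerivWithinAt.fun_sum (u := Finset.univ) fun i _ =>
      HasDerivWithinAt.fun_sum (u := Finset.univ) fun j _ => (hVd i j).pow 2
    refine hgd.congr_deriv ?_
    rw [Matrix.trace] at htr
    simp only [Matrix.diag_apply, Matrix.mul_apply (M := (V s)ᵀ), Matrix.transpose_apply (M := V s)] at htr
    rw [Finset.sum_comm]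
    simp only [Nat.cast_ofNat, Nat.add_one_sub_one, pow_one, mul_assoc, ← Finset.mul_sum, htr,
      mul_zero]
  have hle : g t ≤ g 0 := le_of_deriv_nonpos_off_locallyFinite hD le_rfl ht
    (hgc.mono Set.Icc_subset_Ici_self) fun s hs hsD =>
      ⟨0, (hgd s hs.1 hsD).mono Set.Icc_subset_Ici_self, le_rfl⟩
  have h0 : g 0 = 0 := by simp [hg, hV, h.init]
  have hz : g t = 0 := le_antisymm (h0 ▸ hle)
    (Finset.sum_nonneg fun i _ => Finset.sum_nonneg fun j _ => sq_nonneg _)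
  have hVt : V t = 0 := by
    ext i j
    have h1 := (Finset.sum_eq_zero_iff_of_nonneg fun i _ =>
      Finset.sum_nonneg fun j _ => sq_nonneg (V t i j)).1 hz i (Finset.mem_univ i)
    have h2 := (Finset.sum_eq_zero_iff_of_nonneg fun j _ => sq_nonneg (V t i j)).1 h1 j
      (Finset.mem_univ j)
    exact pow_eq_zero_iff two_ne_zero |>.1 h2
  exact sub_eq_zero.1 hVt

lemma IsFullQR.boundedEntries {n : ℕ} {A Q : ℝ → Mat n n} (h : IsFullQR A Q) :
    BoundedEntries Q := by
  refine ⟨1, fun t ht i j => ?_⟩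
  have h1 : ∑ r, Q t r j ^ 2 = 1 := by
    have := congrFun (congrFun (h.orthogonal ht) j) j
    simpa [Matrix.mul_apply, pow_two] using this
  have h2 : Q t i j ^ 2 ≤ 1 := h1 ▸ Finset.single_le_sum (f := fun r => Q t r j ^ 2)
    (fun r _ => sq_nonneg _) (Finset.mem_univ i)
  exact (sq_le_one_iff_abs_le_one _).1 h2

lemma upperBohl_neg_of_jStar_le {n k : ℕ} {A Q : ℝ → Mat n n} (h : jStar A Q ≤ k) (i : Fin n)
    (hi : k ≤ (i : ℕ)) : upperBohl (fun t => ((Q t)ᵀ * A t * Q t) i i) < 0 := by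
  -- The infimum is attained only on a nonempty set, since `sInf ∅ = 0` is a default value; `n`
  -- belongs to the set vacuously.
  have hne : {j : ℕ | j ≤ n ∧ ∀ i : Fin n, j ≤ (i : ℕ) →
      upperBohl (fun t => ((Q t)ᵀ * A t * Q t) i i) < 0}.Nonempty :=
    ⟨n, le_rfl, fun i hi => absurd i.2 (not_lt.2 hi)⟩
  exact (Nat.sInf_mem hne).2 i (h.trans hi)

/-! ### Quadratic estimates for the Lyapunov function -/

lemma dotProduct_self_nonneg' {ι : Type*} [Fintype ι] (v : ι → ℝ) : 0 ≤ v ⬝ᵥ v :=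
  Finset.sum_nonneg fun i _ => mul_self_nonneg (v i)

lemma LoewnerLE.dotProduct_le {k : ℕ} {M₁ M₂ : Mat k k} (h : LoewnerLE M₁ M₂) (y : Fin k → ℝ) :
    y ⬝ᵥ (M₁ *ᵥ y) ≤ y ⬝ᵥ (M₂ *ᵥ y) := by
  have h1 := h.dotProduct_mulVec_nonneg y
  rw [Matrix.sub_mulVec, dotProduct_sub] at h1
  simpa using h1

lemma dotProduct_smul_one_mulVec {k : ℕ} (p : ℝ) (y : Fin k → ℝ) :
    y ⬝ᵥ ((p • (1 : Mat k k)) *ᵥ y) = p * (y ⬝ᵥ y) := by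
  rw [Matrix.smul_mulVec, Matrix.one_mulVec, dotProduct_smul, smul_eq_mul]

lemma LoewnerLE.transpose_eq {k : ℕ} {p : ℝ} {P : Mat k k} (h : LoewnerLE (p • (1 : Mat k k)) P) :
    Pᵀ = P := by
  have h1 : (P - p • (1 : Mat k k))ᵀ = P - p • (1 : Mat k k) := by
    simpa using h.isHermitian.eq
  simpa using h1

lemma LoewnerLE.det_ne_zero {k : ℕ} {p : ℝ} (hp : 0 < p) {P : Mat k k}
    (h : LoewnerLE (p • (1 : Mat k k)) P) : P.det ≠ 0 := by
  intro hdet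
  obtain ⟨v, hv0, hv⟩ := Matrix.exists_mulVec_eq_zero_iff.2 hdet
  have h1 := h.dotProduct_le v
  rw [hv, dotProduct_zero, dotProduct_smul_one_mulVec] at h1
  have h2 : v ⬝ᵥ v = 0 := le_antisymm (by nlinarith) (dotProduct_self_nonneg' v)
  exact hv0 (dotProduct_self_eq_zero.1 h2)

lemma LoewnerLE.dotProduct_mulVec_comm {k : ℕ} {p : ℝ} {P : Mat k k}
    (h : LoewnerLE (p • (1 : Mat k k)) P) (v w : Fin k → ℝ) :
    v ⬝ᵥ (P *ᵥ w) = w ⬝ᵥ (P *ᵥ v) := by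
  rw [Matrix.dotProduct_mulVec, ← Matrix.mulVec_transpose, h.transpose_eq, dotProduct_comm]

/-- Expanding `0 ≤ |p y - P y|²` and using `p |y|² ≤ yᵀ P y` avoids both eigenvalues and `P⁻¹`; the
next upper bound comes from the same expansion. -/
lemma LoewnerLE.sq_mul_dotProduct_le {k : ℕ} {p : ℝ} (hp : 0 < p) {P : Mat k k}
    (h : LoewnerLE (p • (1 : Mat k k)) P) (y : Fin k → ℝ) :
    p ^ 2 * (y ⬝ᵥ y) ≤ (P *ᵥ y) ⬝ᵥ (P *ᵥ y) := by
  have h1 := mul_le_mul_of_nonneg_left (h.dotProduct_le y) hp.le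
  rw [dotProduct_smul_one_mulVec] at h1
  have h2 := dotProduct_self_nonneg' (p • y - P *ᵥ y)
  simp only [sub_dotProduct, dotProduct_sub, smul_dotProduct, dotProduct_smul, smul_eq_mul,
    dotProduct_comm (P *ᵥ y) y] at h2
  linarith

lemma LoewnerLE.dotProduct_mulVec_le_div {k : ℕ} {p : ℝ} (hp : 0 < p) {P : Mat k k}
    (h : LoewnerLE (p • (1 : Mat k k)) P) (y : Fin k → ℝ) :
    y ⬝ᵥ (P *ᵥ y) ≤ (P *ᵥ y) ⬝ᵥ (P *ᵥ y) / p := by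
  have h1 := mul_le_mul_of_nonneg_left (h.dotProduct_le y) hp.le
  rw [dotProduct_smul_one_mulVec] at h1
  have h2 := dotProduct_self_nonneg' (p • y - P *ᵥ y)
  simp only [sub_dotProduct, dotProduct_sub, smul_dotProduct, dotProduct_smul, smul_eq_mul,
    dotProduct_comm (P *ᵥ y) y] at h2
  rw [le_div_iff₀ hp]
  linarith

/-- This is `P⁻¹ ⪰ 1 / p₂` evaluated at `z = P y`. It follows from `0 ≤ (z - p₂ y)ᵀ P (z - p₂ y)`
once `zᵀ P z` is replaced by its bound `p₂ |z|²`. -/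
lemma div_le_dotProduct_mulVec {k : ℕ} {p₁ p₂ : ℝ} (hp₁ : 0 < p₁) (hp₂ : 0 < p₂) {P : Mat k k}
    (hP₁ : LoewnerLE (p₁ • (1 : Mat k k)) P) (hP₂ : LoewnerLE P (p₂ • (1 : Mat k k)))
    (y : Fin k → ℝ) : (P *ᵥ y) ⬝ᵥ (P *ᵥ y) / p₂ ≤ y ⬝ᵥ (P *ᵥ y) := by
  set z := P *ᵥ y with hz
  have h1 := hP₂.dotProduct_le z
  rw [dotProduct_smul_one_mulVec] at h1
  have h2 := hP₁.dotProduct_le (z - p₂ • y)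
  rw [dotProduct_smul_one_mulVec] at h2
  have h3 := mul_nonneg hp₁.le (dotProduct_self_nonneg' (z - p₂ • y))
  have h4 : y ⬝ᵥ (P *ᵥ z) = z ⬝ᵥ z := by rw [hP₁.dotProduct_mulVec_comm]
  rw [Matrix.mulVec_sub, Matrix.mulVec_smul, ← hz] at h2
  simp only [sub_dotProduct, dotProduct_sub, smul_dotProduct, dotProduct_smul, smul_eq_mul, h4]
    at h2 h3
  rw [div_le_iff₀ hp₂]
  have h5 : 0 ≤ p₂ * (p₂ * (y ⬝ᵥ z) - z ⬝ᵥ z) := by linarith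
  have := nonneg_of_mul_nonneg_right h5 hp₂
  linarith

lemma mulVec_dotProduct_self_le {k : ℕ} {p₁ p₂ : ℝ} (hp₁ : 0 < p₁) (hp₂ : 0 < p₂) {P : Mat k k}
    (hP₁ : LoewnerLE (p₁ • (1 : Mat k k)) P) (hP₂ : LoewnerLE P (p₂ • (1 : Mat k k)))
    (y : Fin k → ℝ) : (P *ᵥ y) ⬝ᵥ (P *ᵥ y) ≤ p₂ ^ 2 * (y ⬝ᵥ y) := by
  have h1 := div_le_dotProduct_mulVec hp₁ hp₂ hP₁ hP₂ y
  have h2 := hP₂.dotProduct_le y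
  rw [dotProduct_smul_one_mulVec] at h2
  rw [div_le_iff₀ hp₂] at h1
  nlinarith

lemma boundedEntries_of_loewnerLE {k : ℕ} {p₁ p₂ : ℝ} (hp₁ : 0 < p₁) (hp₂ : 0 < p₂)
    {P : ℝ → Mat k k} (hP : ∀ t : ℝ, 0 ≤ t →
      LoewnerLE (p₁ • (1 : Mat k k)) (P t) ∧ LoewnerLE (P t) (p₂ • (1 : Mat k k))) :
    BoundedEntries P := by
  refine ⟨p₂, fun t ht i j => ?_⟩
  have h1 := mulVec_dotProduct_self_le hp₁ hp₂ (hP t ht).1 (hP t ht).2 (Pi.single j 1)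
  simp only [Matrix.mulVec_single_one, dotProduct_single_one, Pi.single_eq_same, mul_one] at h1
  have h2 : P t i j * P t i j ≤ (P t).col j ⬝ᵥ (P t).col j :=
    Finset.single_le_sum (f := fun r => P t r j * P t r j) (fun r _ => mul_self_nonneg _)
      (Finset.mem_univ i)
  exact abs_le_of_sq_le_sq (by linarith [pow_two (P t i j)]) hp₂.le

/-- The derivative of `yᵀ P y` along `(P y)˙ = (B - P C̄ᵀ C̄) P y + d` when `P` satisfies the
Riccati equation. -/
lemma riccati_derivative_eq {k p : ℕ} {P B G : Mat k k} {Cb : Mat p k} (hP : Pᵀ = P)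
    {y d : Fin k → ℝ} :
    2 * (y ⬝ᵥ ((B - P * Cbᵀ * Cb) *ᵥ (P *ᵥ y) + d)) -
        y ⬝ᵥ ((B * P + P * Bᵀ - P * Cbᵀ * Cb * P + G) *ᵥ y) =
      2 * (y ⬝ᵥ d) - (Cb *ᵥ (P *ᵥ y)) ⬝ᵥ (Cb *ᵥ (P *ᵥ y)) - y ⬝ᵥ (G *ᵥ y) := by
  have h1 : y ⬝ᵥ ((P * Bᵀ) *ᵥ y) = y ⬝ᵥ ((B * P) *ᵥ y) := by
    rw [Matrix.dotProduct_mulVec, ← Matrix.mulVec_transpose, Matrix.transpose_mul,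
      Matrix.transpose_transpose, hP, dotProduct_comm]
  have h2 : y ⬝ᵥ ((P * Cbᵀ * Cb * P) *ᵥ y) = (Cb *ᵥ (P *ᵥ y)) ⬝ᵥ (Cb *ᵥ (P *ᵥ y)) := by
    rw [Matrix.mulVec_mulVec, Matrix.dotProduct_mulVec _ (Cb * P), Matrix.vecMul_mulVec,
      ← Matrix.dotProduct_mulVec, Matrix.transpose_mul, hP]
    simp only [Matrix.mul_assoc]
  simp only [Matrix.sub_mulVec, Matrix.add_mulVec, dotProduct_add, dotProduct_sub,
    Matrix.mulVec_mulVec, Matrix.sub_mul] at h1 h2 ⊢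
  rw [h1, h2]
  ring

/-! ### Absorbing the couplings between coordinates -/

lemma two_mul_le_scaled {τ : ℝ} (hτ : 0 < τ) (a b : ℝ) : 2 * (a * b) ≤ τ * a ^ 2 + b ^ 2 / τ := by
  have h : τ * a ^ 2 + b ^ 2 / τ - 2 * (a * b) = (τ * a - b) ^ 2 / τ := by field_simp; ring
  have : 0 ≤ (τ * a - b) ^ 2 / τ := by positivity
  linarith

/-- Young's inequality entry by entry. A small `τ` makes the `y` part absorbable by `-yᵀ G y`, at
the price of a large multiple of `|z|²` that the weights of the second block must pay. -/
lemma two_mul_dotProduct_mulVec_le {k l : ℕ} {F : Mat k l} {h τ : ℝ} (hτ : 0 < τ)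
    (hF : ∀ i j, |F i j| ≤ h) (y : Fin k → ℝ) (z : Fin l → ℝ) :
    2 * (y ⬝ᵥ (F *ᵥ z)) ≤ τ * l * (y ⬝ᵥ y) + k * (h ^ 2 / τ) * (z ⬝ᵥ z) := by
  have h1 : 2 * (y ⬝ᵥ (F *ᵥ z)) = ∑ i, ∑ j, 2 * (y i * (F i j * z j)) := by
    simp only [dotProduct, Matrix.mulVec, Finset.mul_sum]
  have h2 : ∀ i j, 2 * (y i * (F i j * z j)) ≤ τ * (y i * y i) + h ^ 2 / τ * (z j * z j) := by
    intro i j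
    refine (two_mul_le_scaled hτ _ _).trans ?_
    have h3 : F i j ^ 2 ≤ h ^ 2 := sq_le_sq.2 ((hF i j).trans (le_abs_self h))
    have h4 : (F i j * z j) ^ 2 / τ ≤ h ^ 2 / τ * (z j * z j) := by
      rw [div_mul_eq_mul_div]
      gcongr
      nlinarith [mul_le_mul_of_nonneg_right h3 (sq_nonneg (z j))]
    linarith [pow_two (y i)]
  rw [h1]
  refine (Finset.sum_le_sum fun i _ => Finset.sum_le_sum fun j _ => h2 i j).trans (le_of_eq ?_)
  simp only [Finset.sum_add_distrib, ← Finset.mul_sum, Finset.sum_const, Finset.card_univ,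
    Fintype.card_fin, nsmul_eq_mul, dotProduct]
  rw [Finset.mul_sum Finset.univ _ (τ * l), Finset.mul_sum Finset.univ _ τ]
  congr 1
  · exact Finset.sum_congr rfl fun i _ => by ring
  · ring

/-- The derivative of `w zᵢ²` along an upper triangular equation `ż = U z + ζ` with
`ẇ = -1 - 2 uᵢᵢ w`. -/
lemma weighted_square_derivative_le {l : ℕ} {U : Mat l l} {h w W : ℝ} (hw : 0 ≤ w) (hwW : w ≤ W)
    (hU : ∀ i j, |U i j| ≤ h) (hU0 : ∀ i j, j < i → U i j = 0) (z ζ : Fin l → ℝ) (i : Fin l) :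
    (-1 - 2 * U i i * w) * z i ^ 2 + w * (2 * z i * ((U *ᵥ z) i + ζ i)) ≤
      -(1 / 2) * z i ^ 2 + (2 * l * W ^ 2 * h ^ 2) * (∑ j, if i < j then z j ^ 2 else 0) +
        2 * W * (|z i| * |ζ i|) := by
  have hl : (0 : ℝ) < l := by exact_mod_cast i.pos
  have hW : 0 ≤ W := hw.trans hwW
  have hsum : (U *ᵥ z) i = U i i * z i + ∑ j, if i < j then U i j * z j else 0 := by
    have h1 : ∀ j, U i j * z j =
        (if j = i then U i i * z i else 0) + if i < j then U i j * z j else 0 := by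
      intro j
      rcases lt_trichotomy j i with hj | rfl | hj
      · simp [hU0 i j hj, hj.ne, hj.not_gt]
      · simp
      · simp [hj, hj.ne']
    rw [Matrix.mulVec, dotProduct, Finset.sum_congr rfl fun j _ => h1 j, Finset.sum_add_distrib,
      Finset.sum_ite_eq' Finset.univ i]
    simp
  -- The diagonal terms cancel by the equation for `w`, leaving `-zᵢ²`. With `τ = 1 / (2 l)` the at
  -- most `l` cross terms use up only half of it.
  have hcross : 2 * w * z i * (∑ j, if i < j then U i j * z j else 0) ≤
      1 / 2 * z i ^ 2 + (2 * l * W ^ 2 * h ^ 2) * (∑ j, if i < j then z j ^ 2 else 0) := by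
    rw [Finset.mul_sum, Finset.mul_sum]
    have h1 : ∀ j, 2 * w * z i * (if i < j then U i j * z j else 0) ≤
        1 / (2 * l) * z i ^ 2 + 2 * l * W ^ 2 * h ^ 2 * (if i < j then z j ^ 2 else 0) := by
      intro j
      split_ifs
      · have h2 := two_mul_le_scaled (τ := 1 / (2 * l)) (by positivity) (z i) (w * U i j * z j)
        have h3 : (w * U i j * z j) ^ 2 ≤ W ^ 2 * h ^ 2 * z j ^ 2 := by
          rw [mul_pow, mul_pow]
          have h4 : U i j ^ 2 ≤ h ^ 2 := sq_le_sq.2 ((hU i j).trans (le_abs_self h))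
          gcongr
        rw [one_div, div_inv_eq_mul, ← one_div] at h2
        have h5 := mul_le_mul_of_nonneg_right h3 (by positivity : (0 : ℝ) ≤ 2 * l)
        linarith
      · rw [mul_zero, mul_zero, add_zero]; positivity
    refine (Finset.sum_le_sum fun j _ => h1 j).trans (le_of_eq ?_)
    rw [Finset.sum_add_distrib, Finset.sum_const, Finset.card_univ, Fintype.card_fin, nsmul_eq_mul]
    field_simp
  have hζ : 2 * w * (z i * ζ i) ≤ 2 * W * (|z i| * |ζ i|) := by
    rw [← abs_mul]
    calc 2 * w * (z i * ζ i) ≤ 2 * w * |z i * ζ i| := by gcongr; exact le_abs_self _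
      _ ≤ 2 * W * |z i * ζ i| := by gcongr
  rw [hsum]
  linarith

/-- The square `z j ^ 2` is charged by the rows `i < j` and by the leading sum: at most `l + 1`
charges, each at most `c γ^j` because `γ^(i+1) ≤ γ^j`. Since `γ ≥ 4c(l+1)`, half of its own decay
`γ^(j+1) / 2` pays for them. The leading sum makes room for the coupling into the first block. -/
lemma weighted_triangular_sum_le {l : ℕ} {c γ : ℝ} (hc : 0 ≤ c) (hγ : 1 ≤ γ)
    (hγc : 4 * c * (l + 1) ≤ γ) (z : Fin l → ℝ) :
    c * (∑ j, z j ^ 2) + ∑ i : Fin l, γ ^ ((i : ℕ) + 1) *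
        (-(1 / 2) * z i ^ 2 + c * ∑ j, if i < j then z j ^ 2 else 0) ≤
      -(1 / 4) * ∑ j, z j ^ 2 := by
  have hγ0 : 0 < γ := by linarith
  have h1 : ∑ i : Fin l, γ ^ ((i : ℕ) + 1) * (c * ∑ j, if i < j then z j ^ 2 else 0) ≤
      ∑ _i : Fin l, ∑ j : Fin l, c * (γ ^ (j : ℕ) * z j ^ 2) := by
    refine Finset.sum_le_sum fun i _ => ?_
    rw [Finset.mul_sum, Finset.mul_sum]
    refine Finset.sum_le_sum fun j _ => ?_
    split_ifs with hij
    · have : γ ^ ((i : ℕ) + 1) ≤ γ ^ (j : ℕ) := pow_le_pow_right₀ hγ hij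
      have h2 := mul_le_mul_of_nonneg_right this (by positivity : 0 ≤ c * z j ^ 2)
      linarith
    · simp only [mul_zero]; positivity
  have h2 : c * (∑ j, z j ^ 2) ≤ ∑ j : Fin l, c * (γ ^ (j : ℕ) * z j ^ 2) := by
    rw [Finset.mul_sum]
    refine Finset.sum_le_sum fun j _ => mul_le_mul_of_nonneg_left ?_ hc
    exact le_mul_of_one_le_left (sq_nonneg _) (one_le_pow₀ hγ)
  have h3 : ∑ j : Fin l, (l + 1) * (c * (γ ^ (j : ℕ) * z j ^ 2)) +
      ∑ j : Fin l, γ ^ ((j : ℕ) + 1) * (-(1 / 2) * z j ^ 2) ≤ -(1 / 4) * ∑ j, z j ^ 2 := by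
    rw [← Finset.sum_add_distrib, Finset.mul_sum]
    refine Finset.sum_le_sum fun j _ => ?_
    have h4 : 1 ≤ γ ^ ((j : ℕ) + 1) := one_le_pow₀ hγ
    have h5 := mul_le_mul_of_nonneg_right hγc (by positivity : 0 ≤ γ ^ (j : ℕ) * z j ^ 2)
    have h6 := mul_le_mul_of_nonneg_right h4 (sq_nonneg (z j))
    rw [pow_succ γ] at h6 ⊢
    linarith
  rw [Finset.sum_const, Finset.card_univ, Fintype.card_fin, nsmul_eq_mul] at h1
  rw [← Finset.mul_sum] at h3
  simp only [mul_add (γ ^ _), Finset.sum_add_distrib]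
  linarith

lemma dotProduct_le_sum_of_abs_le {k : ℕ} {y ζ : Fin k → ℝ} {a s : ℝ} (ha : ∀ i, |y i| ≤ a)
    (hs : ∀ i, |ζ i| ≤ s) : y ⬝ᵥ ζ ≤ k * (a * s) := by
  calc y ⬝ᵥ ζ ≤ ∑ _i : Fin k, a * s := Finset.sum_le_sum fun i _ =>
        (le_abs_self _).trans (by
          rw [abs_mul]
          exact mul_le_mul (ha i) (hs i) (abs_nonneg _) ((abs_nonneg _).trans (ha i)))
    _ = k * (a * s) := by simp

lemma abs_apply_le_of_dotProduct_self_le {k : ℕ} {y : Fin k → ℝ} {q : ℝ} (hq : 0 ≤ q)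
    (h : y ⬝ᵥ y ≤ q ^ 2) (i : Fin k) : |y i| ≤ q := by
  refine abs_le_of_sq_le_sq ?_ hq
  refine le_trans ?_ h
  rw [pow_two]
  exact Finset.single_le_sum (f := fun r => y r * y r) (fun r _ => mul_self_nonneg _)
    (Finset.mem_univ i)

/-- The Lyapunov function `yᵀ z₁ + ∑ γ^(i+1) wᵢ z₂ᵢ²` with `z₁ = P y` is comparable with the
squared norm. -/
lemma lyapunov_bounds {k l : ℕ} {p₁ p₂ w₁ W γ : ℝ} (hp₁ : 0 < p₁) (hp₂ : 0 < p₂) (hw₁ : 0 < w₁)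
    (hγ : 1 ≤ γ) {P : Mat k k} (hP₁ : LoewnerLE (p₁ • (1 : Mat k k)) P)
    (hP₂ : LoewnerLE P (p₂ • (1 : Mat k k))) {w : Fin l → ℝ} (hw : ∀ i, w₁ ≤ w i ∧ w i ≤ W)
    (hW : 0 ≤ W) (y : Fin k → ℝ) (z : Fin l → ℝ) :
    min (1 / p₂) w₁ * ((P *ᵥ y) ⬝ᵥ (P *ᵥ y) + z ⬝ᵥ z) ≤
        y ⬝ᵥ (P *ᵥ y) + ∑ i : Fin l, γ ^ ((i : ℕ) + 1) * (w i * z i ^ 2) ∧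
      y ⬝ᵥ (P *ᵥ y) + ∑ i : Fin l, γ ^ ((i : ℕ) + 1) * (w i * z i ^ 2) ≤
        (1 / p₁ + γ ^ l * W) * ((P *ᵥ y) ⬝ᵥ (P *ᵥ y) + z ⬝ᵥ z) := by
  have h1 := div_le_dotProduct_mulVec hp₁ hp₂ hP₁ hP₂ y
  have h2 := hP₁.dotProduct_mulVec_le_div hp₁ y
  have hN1 := dotProduct_self_nonneg' (P *ᵥ y)
  have hN2 := dotProduct_self_nonneg' z
  have h3 : w₁ * (z ⬝ᵥ z) ≤ ∑ i : Fin l, γ ^ ((i : ℕ) + 1) * (w i * z i ^ 2) := by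
    rw [dotProduct, Finset.mul_sum]
    refine Finset.sum_le_sum fun i _ => ?_
    have h4 : 1 ≤ γ ^ ((i : ℕ) + 1) := one_le_pow₀ hγ
    have h5 : w₁ * (z i * z i) ≤ w i * z i ^ 2 := by
      rw [← pow_two]; exact mul_le_mul_of_nonneg_right (hw i).1 (sq_nonneg _)
    refine h5.trans (le_mul_of_one_le_left ?_ h4)
    exact mul_nonneg (hw₁.le.trans (hw i).1) (sq_nonneg _)
  have h6 : ∑ i : Fin l, γ ^ ((i : ℕ) + 1) * (w i * z i ^ 2) ≤ γ ^ l * W * (z ⬝ᵥ z) := by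
    rw [dotProduct, Finset.mul_sum]
    refine Finset.sum_le_sum fun i _ => ?_
    have h4 : γ ^ ((i : ℕ) + 1) ≤ γ ^ l := pow_le_pow_right₀ hγ i.2
    have h7 : 0 ≤ W * z i ^ 2 := by positivity
    calc γ ^ ((i : ℕ) + 1) * (w i * z i ^ 2) ≤ γ ^ ((i : ℕ) + 1) * (W * z i ^ 2) := by
          have : 0 < γ := by linarith
          gcongr; exact (hw i).2
      _ ≤ γ ^ l * (W * z i ^ 2) := mul_le_mul_of_nonneg_right h4 h7
      _ = _ := by ring
  constructor
  · have h7 := mul_le_mul_of_nonneg_right (min_le_left (1 / p₂) w₁) hN1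
    have h8 := mul_le_mul_of_nonneg_right (min_le_right (1 / p₂) w₁) hN2
    rw [one_div_mul_eq_div] at h7
    linarith
  · have h7 : 0 ≤ γ ^ l * W * ((P *ᵥ y) ⬝ᵥ (P *ᵥ y)) := by positivity
    have h8 : 0 ≤ 1 / p₁ * (z ⬝ᵥ z) := by positivity
    have h9 : 1 / p₁ * ((P *ᵥ y) ⬝ᵥ (P *ᵥ y)) = (P *ᵥ y) ⬝ᵥ (P *ᵥ y) / p₁ := one_div_mul_eq_div _ _
    linarith

/-- The derivative of the Lyapunov function is negative up to the contribution of the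
nonlinearity. -/
lemma lyapunov_derivative_le {k l : ℕ} {p₁ p₂ g h W γ : ℝ} (hp₁ : 0 < p₁) (hp₂ : 0 < p₂)
    (hg : 0 < g) (hγ : 1 ≤ γ) (hW : 0 ≤ W)
    (hγc : 4 * (k * (h ^ 2 / (g / (2 * (l + 1)))) + 2 * l * W ^ 2 * h ^ 2) * (l + 1) ≤ γ)
    {P G : Mat k k} (hP₁ : LoewnerLE (p₁ • (1 : Mat k k)) P)
    (hP₂ : LoewnerLE P (p₂ • (1 : Mat k k))) (hG : LoewnerLE (g • (1 : Mat k k)) G)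
    {F : Mat k l} (hF : ∀ i j, |F i j| ≤ h) {U : Mat l l} (hU : ∀ i j, |U i j| ≤ h)
    (hU0 : ∀ i j, j < i → U i j = 0) {w : Fin l → ℝ} (hw : ∀ i, 0 ≤ w i ∧ w i ≤ W)
    {y ζ₁ : Fin k → ℝ} {z ζ₂ : Fin l → ℝ} {q s : ℝ} (hq : 0 ≤ q)
    (hqz : (P *ᵥ y) ⬝ᵥ (P *ᵥ y) + z ⬝ᵥ z = q ^ 2) (hζ₁ : ∀ i, |ζ₁ i| ≤ s)
    (hζ₂ : ∀ i, |ζ₂ i| ≤ s) :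
    2 * (y ⬝ᵥ (F *ᵥ z + ζ₁)) - y ⬝ᵥ (G *ᵥ y) + ∑ i : Fin l, γ ^ ((i : ℕ) + 1) *
        ((-1 - 2 * U i i * w i) * z i ^ 2 + w i * (2 * z i * ((U *ᵥ z) i + ζ₂ i))) ≤
      -min (g / (2 * p₂ ^ 2)) (1 / 4) * q ^ 2 + (2 * k / p₁ + 2 * W * γ ^ l * l) * (q * s) := by
  have hγ0 : 0 < γ := by linarith
  have hN1 := dotProduct_self_nonneg' (P *ᵥ y)
  have hN2 := dotProduct_self_nonneg' z
  -- Chosen so that `τ l ≤ g / 2`, which spends half of `-yᵀ G y`; `l + 1` covers `l = 0`.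
  set τ : ℝ := g / (2 * (l + 1)) with hτdef
  have hτ : 0 < τ := by positivity
  set c : ℝ := k * (h ^ 2 / τ) + 2 * l * W ^ 2 * h ^ 2 with hc
  have hc0 : 0 ≤ c := by positivity
  have hc1 : k * (h ^ 2 / τ) ≤ c := by rw [hc]; linarith [(by positivity : 0 ≤ 2 * l * W ^ 2 * h ^ 2)]
  have hc2 : 2 * l * W ^ 2 * h ^ 2 ≤ c := by rw [hc]; linarith [(by positivity : 0 ≤ k * (h ^ 2 / τ))]
  have hzz : z ⬝ᵥ z = ∑ j, z j ^ 2 := by simp [dotProduct, pow_two]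
  have hyy := dotProduct_self_nonneg' y
  have hyz := hP₁.sq_mul_dotProduct_le hp₁ y
  have hyq : ∀ i, |y i| ≤ q / p₁ := abs_apply_le_of_dotProduct_self_le (by positivity) (by
    rw [div_pow, le_div_iff₀ (by positivity)]; linarith)
  have hzq : ∀ i, |z i| ≤ q := abs_apply_le_of_dotProduct_self_le hq (by linarith)
  have hGy := hG.dotProduct_le y
  rw [dotProduct_smul_one_mulVec] at hGy
  have hylow := mulVec_dotProduct_self_le hp₁ hp₂ hP₁ hP₂ y
  have h1 := two_mul_dotProduct_mulVec_le hτ hF y z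
  have h2 : τ * l * (y ⬝ᵥ y) ≤ g / 2 * (y ⬝ᵥ y) := by
    refine mul_le_mul_of_nonneg_right ?_ hyy
    rw [hτdef, div_mul_eq_mul_div, div_le_div_iff₀ (by positivity) (by positivity)]
    nlinarith
  have h3 := mul_le_mul_of_nonneg_right hc1 hN2
  have h4 := dotProduct_le_sum_of_abs_le hyq hζ₁
  have h5 : g / (2 * p₂ ^ 2) * ((P *ᵥ y) ⬝ᵥ (P *ᵥ y)) ≤ g / 2 * (y ⬝ᵥ y) := by
    rw [div_mul_eq_mul_div, div_le_iff₀ (by positivity)]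
    nlinarith
  have h6 : ∑ i : Fin l, γ ^ ((i : ℕ) + 1) *
        ((-1 - 2 * U i i * w i) * z i ^ 2 + w i * (2 * z i * ((U *ᵥ z) i + ζ₂ i))) ≤
      ∑ i : Fin l, γ ^ ((i : ℕ) + 1) *
        (-(1 / 2) * z i ^ 2 + c * ∑ j, if i < j then z j ^ 2 else 0) +
      ∑ _i : Fin l, γ ^ l * (2 * W * (q * s)) := by
    rw [← Finset.sum_add_distrib]
    refine Finset.sum_le_sum fun i _ => ?_
    have h7 := weighted_square_derivative_le (hw i).1 (hw i).2 hU hU0 z ζ₂ i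
    have h8 : 0 ≤ ∑ j, if i < j then z j ^ 2 else 0 :=
      Finset.sum_nonneg fun j _ => by split_ifs <;> positivity
    have h9 := mul_le_mul_of_nonneg_right hc2 h8
    have h10 : |z i| * |ζ₂ i| ≤ q * s := mul_le_mul (hzq i) (hζ₂ i) (abs_nonneg _) hq
    have h11 := mul_le_mul_of_nonneg_left h10 (by positivity : 0 ≤ 2 * W)
    have h12 : γ ^ ((i : ℕ) + 1) ≤ γ ^ l := pow_le_pow_right₀ hγ i.2
    have h13 : 0 ≤ 2 * W * (q * s) :=
      mul_nonneg (by positivity) (mul_nonneg hq ((abs_nonneg _).trans (hζ₂ i)))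
    have h14 := mul_le_mul_of_nonneg_right h12 h13
    have h15 : (-1 - 2 * U i i * w i) * z i ^ 2 + w i * (2 * z i * ((U *ᵥ z) i + ζ₂ i)) ≤
        (-(1 / 2) * z i ^ 2 + c * ∑ j, if i < j then z j ^ 2 else 0) + 2 * W * (q * s) := by
      linarith
    have h16 := mul_le_mul_of_nonneg_left h15 (by positivity : 0 ≤ γ ^ ((i : ℕ) + 1))
    rw [mul_add] at h16
    linarith
  have h7 := weighted_triangular_sum_le hc0 hγ hγc z
  rw [Finset.sum_const, Finset.card_univ, Fintype.card_fin, nsmul_eq_mul] at h6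
  rw [← hzz] at h7
  rw [dotProduct_add]
  have h8 := mul_le_mul_of_nonneg_right (min_le_left (g / (2 * p₂ ^ 2)) (1 / 4)) hN1
  have h9 := mul_le_mul_of_nonneg_right (min_le_right (g / (2 * p₂ ^ 2)) (1 / 4)) hN2
  have h10 : k * (q / p₁ * s) = k / p₁ * (q * s) := by ring
  have h11 : 2 * k / p₁ * (q * s) = 2 * (k / p₁ * (q * s)) := by ring
  rw [← hqz, add_mul, h11]
  linarith

/-! ### The closed loop in the coordinates of the QR decomposition -/

/-- The system matrix of the linearized error dynamics in the coordinates `z = Qᵀ e`. -/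
def qrClosedLoop {k l p : ℕ} (A Q : Mat (k + l) (k + l)) (C : Mat p (k + l)) (Qbar : Mat (k + l) k)
    (P : Mat k k) : Mat (k + l) (k + l) :=
  qrB A Q - Qᵀ * (observerGain C Qbar P * C) * Q

section ClosedLoop

variable {k l p : ℕ} {A Q : Mat (k + l) (k + l)} {C : Mat p (k + l)} {Qbar : Mat (k + l) k}
  {P : Mat k k}

lemma transpose_mul_gain_castAdd (hQ : Qᵀ * Q = 1) (hQb : Qbar = Q.submatrix id (Fin.castAdd l))
    (i : Fin k) (j : Fin (k + l)) :
    (Qᵀ * (observerGain C Qbar P * C) * Q) (Fin.castAdd l i) j =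
      (P * (C * Qbar)ᵀ * (C * Q)) i j := by
  have h1 : Qᵀ * (observerGain C Qbar P * C) * Q =
      (Qᵀ * Qbar) * (P * (C * Qbar)ᵀ * (C * Q)) := by
    simp only [observerGain, Matrix.mul_assoc]
  have h2 : ∀ r, (Qᵀ * Qbar) (Fin.castAdd l i) r = (1 : Mat k k) i r := by
    intro r
    have := congrFun (congrFun hQ (Fin.castAdd l i)) (Fin.castAdd l r)
    rw [Matrix.one_apply] at this ⊢
    simpa [hQb, Matrix.mul_apply] using this
  rw [h1, Matrix.mul_apply]
  simp only [h2]
  rw [← Matrix.mul_apply, Matrix.one_mul]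

/-- The gain maps into the span of the columns of `Q̄`, to which the remaining columns of `Q` are
orthogonal. -/
lemma transpose_mul_gain_natAdd (hQ : Qᵀ * Q = 1) (hQb : Qbar = Q.submatrix id (Fin.castAdd l))
    (i : Fin l) (j : Fin (k + l)) :
    (Qᵀ * (observerGain C Qbar P * C) * Q) (Fin.natAdd k i) j = 0 := by
  have h1 : Qᵀ * (observerGain C Qbar P * C) * Q =
      (Qᵀ * Qbar) * (P * (C * Qbar)ᵀ * (C * Q)) := by
    simp only [observerGain, Matrix.mul_assoc]
  have h2 : ∀ r, (Qᵀ * Qbar) (Fin.natAdd k i) r = 0 := by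
    intro r
    have := congrFun (congrFun hQ (Fin.natAdd k i)) (Fin.castAdd l r)
    rw [Matrix.one_apply_ne (by
      intro h; have := congrArg Fin.val h; have h3 := r.2
      simp only [Fin.val_natAdd, Fin.val_castAdd] at this; omega)] at this
    simpa [hQb, Matrix.mul_apply] using this
  rw [h1, Matrix.mul_apply]
  simp [h2]

lemma qrB_apply_of_lt {n : ℕ} {A Q : Mat n n} {i j : Fin n} (h : j < i) : qrB A Q i j = 0 := by
  simp [qrB, qrSkew, skewOfLower, h]

lemma qrB_apply_self {n : ℕ} (A Q : Mat n n) (i : Fin n) : qrB A Q i i = (Qᵀ * A * Q) i i := by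
  simp [qrB, qrSkew, skewOfLower]

lemma qrClosedLoop_castAdd_castAdd (hQ : Qᵀ * Q = 1)
    (hQb : Qbar = Q.submatrix id (Fin.castAdd l)) (i j : Fin k) :
    qrClosedLoop A Q C Qbar P (Fin.castAdd l i) (Fin.castAdd l j) =
      (qrB A Qbar - P * (C * Qbar)ᵀ * (C * Qbar)) i j := by
  rw [qrClosedLoop, Matrix.sub_apply, Matrix.sub_apply, transpose_mul_gain_castAdd hQ hQb]
  have h0 : ∀ i j, (Qbarᵀ * A * Qbar) i j =
      (Qᵀ * A * Q) (Fin.castAdd l i) (Fin.castAdd l j) := by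
    intro i j; simp [hQb, Matrix.mul_apply]
  congr 1
  -- `Fin.castAdd` preserves the order of indices, so the skew part of the leading block is the
  -- leading block of the skew part.
  · simp only [qrB, qrSkew, skewOfLower, Matrix.sub_apply, Matrix.of_apply, h0]
    rfl
  · simp [hQb, Matrix.mul_apply]

lemma qrClosedLoop_natAdd_castAdd (hQ : Qᵀ * Q = 1)
    (hQb : Qbar = Q.submatrix id (Fin.castAdd l)) (i : Fin l) (j : Fin k) :
    qrClosedLoop A Q C Qbar P (Fin.natAdd k i) (Fin.castAdd l j) = 0 := by
  rw [qrClosedLoop, Matrix.sub_apply, transpose_mul_gain_natAdd hQ hQb, qrB_apply_of_lt, sub_zero]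
  rw [Fin.lt_def, Fin.val_natAdd, Fin.val_castAdd]
  have := j.2
  omega

lemma qrClosedLoop_natAdd_natAdd (hQ : Qᵀ * Q = 1)
    (hQb : Qbar = Q.submatrix id (Fin.castAdd l)) (i j : Fin l) :
    qrClosedLoop A Q C Qbar P (Fin.natAdd k i) (Fin.natAdd k j) =
      qrB A Q (Fin.natAdd k i) (Fin.natAdd k j) := by
  rw [qrClosedLoop, Matrix.sub_apply, transpose_mul_gain_natAdd hQ hQb, sub_zero]

/-- The first block of the closed loop. -/
lemma qrClosedLoop_mulVec_castAdd (hQ : Qᵀ * Q = 1)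
    (hQb : Qbar = Q.submatrix id (Fin.castAdd l)) (z : Fin (k + l) → ℝ) (i : Fin k) :
    (qrClosedLoop A Q C Qbar P *ᵥ z) (Fin.castAdd l i) =
      ((qrB A Qbar - P * (C * Qbar)ᵀ * (C * Qbar)) *ᵥ (fun j => z (Fin.castAdd l j)) +
        ((qrClosedLoop A Q C Qbar P).submatrix (Fin.castAdd l) (Fin.natAdd k)) *ᵥ
          (fun j => z (Fin.natAdd k j))) i := by
  simp only [Matrix.mulVec, dotProduct, Pi.add_apply, Fin.sum_univ_add,
    qrClosedLoop_castAdd_castAdd hQ hQb, Matrix.submatrix_apply]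

/-- The second block of the closed loop. -/
lemma qrClosedLoop_mulVec_natAdd (hQ : Qᵀ * Q = 1)
    (hQb : Qbar = Q.submatrix id (Fin.castAdd l)) (z : Fin (k + l) → ℝ) (i : Fin l) :
    (qrClosedLoop A Q C Qbar P *ᵥ z) (Fin.natAdd k i) =
      (((qrClosedLoop A Q C Qbar P).submatrix (Fin.natAdd k) (Fin.natAdd k)) *ᵥ
          (fun j => z (Fin.natAdd k j))) i := by
  simp only [Matrix.mulVec, dotProduct, Fin.sum_univ_add,
    qrClosedLoop_natAdd_castAdd hQ hQb, Matrix.submatrix_apply]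
  simp

/-- The error dynamics in the coordinates `z = Qᵀ e`. -/
lemma qr_coordinates_derivative (hQ : Qᵀ * Q = 1) (e η : Fin (k + l) → ℝ) :
    (Q * qrSkew A Q)ᵀ *ᵥ e + Qᵀ *ᵥ ((A - observerGain C Qbar P * C) *ᵥ e + η) =
      qrClosedLoop A Q C Qbar P *ᵥ (Qᵀ *ᵥ e) + Qᵀ *ᵥ η := by
  have hQ' : Q * Qᵀ = 1 := mul_eq_one_comm.1 hQ
  have hS : (qrSkew A Q)ᵀ = -qrSkew A Q := skewOfLower_transpose _
  rw [Matrix.mulVec_add, ← add_assoc, Matrix.mulVec_mulVec, Matrix.mulVec_mulVec,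
    ← Matrix.add_mulVec]
  congr 2
  rw [qrClosedLoop, qrB, Matrix.transpose_mul, hS]
  simp only [Matrix.sub_mul, Matrix.mul_sub, Matrix.mul_assoc, hQ', Matrix.mul_one, Matrix.neg_mul]
  abel

end ClosedLoop

/-! ### The error dynamics -/

lemma matVec_mul {n m p : ℕ} (M : Mat n m) (N : Mat m p) (v : Vec p) :
    matVec (M * N) v = matVec M (matVec N v) := by
  simp [matVec, Matrix.toLpLin_apply, Matrix.mulVec_mulVec]

lemma matVec_sub_left {n m : ℕ} (M N : Mat n m) (v : Vec m) :
    matVec (M - N) v = matVec M v - matVec N v := by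
  simp [matVec]

lemma SolvesOn.sub {E : Type} [NormedAddCommGroup E] [NormedSpace ℝ E] {I : Set ℝ}
    {x₁ x₂ v₁ v₂ : ℝ → E} (h₁ : SolvesOn I x₁ v₁) (h₂ : SolvesOn I x₂ v₂) :
    SolvesOn I (fun t => x₁ t - x₂ t) (fun t => v₁ t - v₂ t) := by
  obtain ⟨hc₁, D₁, hD₁, hd₁⟩ := h₁
  obtain ⟨hc₂, D₂, hD₂, hd₂⟩ := h₂
  exact ⟨hc₁.sub hc₂, D₁ ∪ D₂, hD₁.union hD₂, fun t ht htD =>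
    (hd₁ t ht fun h => htD (Or.inl h)).sub (hd₂ t ht fun h => htD (Or.inr h))⟩

/-- With `e = x - x̂` the Jacobian terms of the linear part and of the Taylor remainder cancel,
which leaves the plant field minus the observer field. -/
lemma errorField_sub {n m p k : ℕ} (f : Vec n → Vec m → Vec n) (C : ℝ → Mat p n)
    (u : ℝ → Vec m) (xhat : ℝ → Vec n) (Qbar : ℝ → Mat n k) (P₁ : ℝ → Mat k k) (t : ℝ)
    (x : Vec n) :
    errorField f C u xhat Qbar P₁ t (x - xhat t) =
      f x (u t) - (f (xhat t) (u t) + matVec (observerGain (C t) (Qbar t) (P₁ t))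
        (matVec (C t) x - matVec (C t) (xhat t))) := by
  have h : matVec (C t) (x - xhat t) = matVec (C t) x - matVec (C t) (xhat t) := map_sub _ _ _
  rw [errorField, taylorRemainder, matVec_sub_left, matVec_mul, add_sub_cancel, jacobianAlong, h]
  abel

lemma errorField_zero {n m p k : ℕ} (f : Vec n → Vec m → Vec n) (C : ℝ → Mat p n)
    (u : ℝ → Vec m) (xhat : ℝ → Vec n) (Qbar : ℝ → Mat n k) (P₁ : ℝ → Mat k k) (t : ℝ) :
    errorField f C u xhat Qbar P₁ t 0 = 0 := by
  simp [errorField, taylorRemainder, matVec]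

lemma SolvesOn.hasDerivWithinAt_apply {n : ℕ} {I : Set ℝ} {e v : ℝ → Vec n} (h : SolvesOn I e v) :
    (∀ i, ContinuousOn (fun t => e t i) I) ∧ ∃ D : Set ℝ, LocallyFiniteTimes D ∧
      ∀ t ∈ I, t ∉ D → ∀ i, HasDerivWithinAt (fun t => e t i) (v t i) I t := by
  obtain ⟨hc, D, hD, hd⟩ := h
  refine ⟨fun i => (EuclideanSpace.proj (𝕜 := ℝ) i).continuous.comp_continuousOn hc, D, hD,
    fun t ht htD i => ?_⟩
  exact (EuclideanSpace.proj (𝕜 := ℝ) i).hasFDerivAt.comp_hasDerivWithinAt t (hd t ht htD)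

lemma norm_sq_eq_dotProduct {n : ℕ} (v : Vec n) : ‖v‖ ^ 2 = v.ofLp ⬝ᵥ v.ofLp := by
  rw [EuclideanSpace.real_norm_sq_eq]
  simp [dotProduct, pow_two]

lemma orthogonal_dotProduct {n : ℕ} {Q : Mat n n} (hQ : Qᵀ * Q = 1) (v : Fin n → ℝ) :
    (Qᵀ *ᵥ v) ⬝ᵥ (Qᵀ *ᵥ v) = v ⬝ᵥ v := by
  have hQ' : Q * Qᵀ = 1 := mul_eq_one_comm.1 hQ
  rw [Matrix.dotProduct_mulVec, Matrix.vecMul_transpose, Matrix.mulVec_mulVec, hQ',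
    Matrix.one_mulVec]

/-- The derivative of `2 zᵀ y - yᵀ P y`, which equals `yᵀ P y` when `z = P y`, does not involve
the derivative of `y`. -/
lemma hasDerivWithinAt_two_mul_dotProduct_sub {k : ℕ} {P : ℝ → Mat k k} {P' : Mat k k}
    {z y : ℝ → Fin k → ℝ} {z' : Fin k → ℝ} {S : Set ℝ} {t : ℝ} (hP : HasEntryDerivAt P P' S t)
    (hz : ∀ i, HasDerivWithinAt (fun t => z t i) (z' i) S t)
    (hy : ∀ i, DifferentiableWithinAt ℝ (fun t => y t i) S t) (hsymm : (P t)ᵀ = P t)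
    (hzy : z t = P t *ᵥ y t) :
    HasDerivWithinAt (fun t => 2 * (z t ⬝ᵥ y t) - y t ⬝ᵥ (P t *ᵥ y t))
      (2 * (y t ⬝ᵥ z') - y t ⬝ᵥ (P' *ᵥ y t)) S t := by
  have hy' := fun i => (hy i).hasDerivWithinAt
  set y' : Fin k → ℝ := fun i => derivWithin (fun t => y t i) S t
  have h1 := hasDerivWithinAt_dotProduct hz hy'
  have h2 := hasDerivWithinAt_dotProduct hy' (hP.mulVec hy')
  refine ((h1.const_mul 2).sub h2).congr_deriv ?_
  -- For symmetric `P`, the vector `y` with `P y = z` is a critical point of `2 zᵀ y - yᵀ P y`, so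
  -- the terms in `y'` cancel.
  have h3 : y t ⬝ᵥ (P t *ᵥ y') = y' ⬝ᵥ (P t *ᵥ y t) := by
    rw [Matrix.dotProduct_mulVec, ← Matrix.mulVec_transpose, hsymm, dotProduct_comm]
  rw [hzy, dotProduct_add, dotProduct_comm z' (y t), dotProduct_comm (P t *ᵥ y t)]
  change 2 * (y t ⬝ᵥ z' + y' ⬝ᵥ (P t *ᵥ y t)) - (y' ⬝ᵥ (P t *ᵥ y t) +
    (y t ⬝ᵥ (P' *ᵥ y t) + y t ⬝ᵥ (P t *ᵥ y'))) = _
  rw [h3]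
  ring

/-- The weights of the columns of `Q` with negative upper Bohl exponents, with common bounds. -/
lemma exists_weights {k l : ℕ} {A Q : ℝ → Mat (k + l) (k + l)} (hQ : IsFullQR A Q)
    (hA : BoundedEntries A) {D : Set ℝ} (hD : LocallyFiniteTimes D)
    (hAc : ∀ t : ℝ, 0 ≤ t → t ∉ D → ContinuousWithinAt A (Set.Ici 0) t) (hj : jStar A Q ≤ k) :
    ∃ w : Fin l → ℝ → ℝ, (∀ i, Continuous (w i)) ∧
      (∃ w₁ W : ℝ, 0 < w₁ ∧ 0 ≤ W ∧ ∀ i t, 0 ≤ t → w₁ ≤ w i t ∧ w i t ≤ W) ∧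
      ∀ i (t : ℝ) (S : Set ℝ), 0 ≤ t → t ∉ D → HasDerivWithinAt (w i)
        (-1 - 2 * ((Q t)ᵀ * A t * Q t) (Fin.natAdd k i) (Fin.natAdd k i) * w i t) S t := by
  obtain ⟨a, ha⟩ := (hQ.boundedEntries.transpose.mul hA).mul hQ.boundedEntries
  have hQc : ∀ i j, ContinuousOn (fun t => Q t i j) (Set.Ici 0) := fun i j => (hQ.ode i j).1
  choose w hwc hb hwd using fun i : Fin l => exists_weight_of_upperBohl_neg
    (b := fun t => ((Q t)ᵀ * A t * Q t) (Fin.natAdd k i) (Fin.natAdd k i)) (a := a)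
    (fun t ht => ha t ht _ _) hD (fun t ht htD => by
      have hAe : ∀ r s, ContinuousWithinAt (fun t => A t r s) (Set.Ici 0) t := fun r s =>
        ((continuous_id.matrix_elem r s).continuousAt).comp_continuousWithinAt (hAc t ht htD)
      simp only [Matrix.mul_apply, Matrix.transpose_apply]
      exact tendsto_finsetSum _ fun r _ => ContinuousWithinAt.mul
        (tendsto_finsetSum _ fun s _ => ContinuousWithinAt.mul (hQc _ _ t ht) (hAe _ _))
        (hQc _ _ t ht))
    (upperBohl_neg_of_jStar_le hj (Fin.natAdd k i) (by simp))
  choose w₁ w₂ hw₁ hwb using hb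
  have h1 : ∀ᶠ ω in nhdsWithin (0 : ℝ) (Set.Ioi 0), ∀ i, ω ≤ w₁ i :=
    Filter.eventually_all.2 fun i => nhdsWithin_le_nhds (Iic_mem_nhds (hw₁ i))
  obtain ⟨ω, hω, hω0⟩ := (h1.and self_mem_nhdsWithin).exists
  obtain ⟨W, hW, hW0⟩ := ((Filter.eventually_all.2 fun i => Filter.eventually_ge_atTop (w₂ i)).and
    (Filter.eventually_ge_atTop (0 : ℝ))).exists
  exact ⟨w, hwc, ⟨ω, W, hω0, hW0, fun i t ht =>
    ⟨(hω i).trans (hwb i t ht).1, (hwb i t ht).2.trans (hW i)⟩⟩, hwd⟩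

/-- Exponential stability of the error dynamics, from the data of the observer. -/
theorem errorField_locallyUniformlyExpStable {m p k l : ℕ}
    {f : Vec (k + l) → Vec m → Vec (k + l)} {C : ℝ → Mat p (k + l)}
    (hC : ∃ c : ℝ, ∀ t : ℝ, 0 ≤ t → ‖C t‖ ≤ c) {u : ℝ → Vec m} {y : ℝ → Vec p}
    {G₁ : ℝ → Mat k k} {xhat : ℝ → Vec (k + l)} {Qbar : ℝ → Mat (k + l) k} {P₁ : ℝ → Mat k k}
    (hobs : IsExtendedSubspaceObserver f C u y G₁ xhat Qbar P₁)
    (hA : PiecewiseContinuous (jacobianAlong f xhat u))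
    {Q : ℝ → Mat (k + l) (k + l)} (hQ : IsFullQR (jacobianAlong f xhat u) Q)
    (hQbar : ∀ t : ℝ, 0 ≤ t → Qbar t = (Q t).submatrix id (Fin.castAdd l))
    (hjk : jStar (jacobianAlong f xhat u) Q ≤ k)
    (a1 : ∃ a : ℝ, ∀ t : ℝ, 0 ≤ t → ‖jacobianAlong f xhat u t‖ ≤ a)
    (a2 : ∃ p₁ p₂ : ℝ, 0 < p₁ ∧ 0 < p₂ ∧ ∀ t : ℝ, 0 ≤ t →
      LoewnerLE (p₁ • (1 : Mat k k)) (P₁ t) ∧ LoewnerLE (P₁ t) (p₂ • (1 : Mat k k)))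
    (a3 : ∃ ε κ : ℝ, 0 < ε ∧ 0 < κ ∧ ∀ (e z : Vec (k + l)) (v : Vec m), ‖e‖ ≤ ε →
      ‖taylorRemainder f e z v‖ ≤ κ * ‖e‖ ^ 2) :
    LocallyUniformlyExpStable (errorField f C u xhat Qbar P₁) := by
  set A := jacobianAlong f xhat u with hAdef
  obtain ⟨p₁, p₂, hp₁, hp₂, hP⟩ := a2
  obtain ⟨ε, κ, hε, hκ, hη⟩ := a3
  obtain ⟨g, _, hg, -, hG⟩ := hobs.weight
  obtain ⟨DA, hDA, hAc⟩ := hA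
  obtain ⟨DQ, hDQ, hQd⟩ := hQ.ode.exists_hasEntryDerivAt
  obtain ⟨DP, hDP, hPd⟩ := hobs.riccati.exists_hasEntryDerivAt
  have hQc : ∀ i j, ContinuousOn (fun t => Q t i j) (Set.Ici 0) := fun i j => (hQ.ode i j).1
  have hPc : ∀ i j, ContinuousOn (fun t => P₁ t i j) (Set.Ici 0) := fun i j =>
    (hobs.riccati i j).1
  have hAb : BoundedEntries A := boundedEntries_of_norm_le a1
  obtain ⟨w, hwc, ⟨w₁, W, hw₁, hW, hwb⟩, hwd⟩ := exists_weights hQ hAb hDA hAc hjk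
  have hQb := hQ.boundedEntries
  have hQbarb : BoundedEntries Qbar := hQb.imp fun c hc t ht i j => by
    rw [hQbar t ht]; exact hc t ht _ _
  have hCb : BoundedEntries C := boundedEntries_of_norm_le hC
  have hPb : BoundedEntries P₁ := boundedEntries_of_loewnerLE hp₁ hp₂ hP
  have hQAQ := (hQb.transpose.mul hAb).mul hQb
  set H : ℝ → Mat (k + l) (k + l) := fun t => qrClosedLoop (A t) (Q t) (C t) (Qbar t) (P₁ t)
    with hHdef
  have hHb : BoundedEntries H := (hQAQ.sub hQAQ.skewOfLower).sub ((hQb.transpose.mul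
    (((hQbarb.mul hPb).mul (hCb.mul hQbarb).transpose).mul hCb)).mul hQb)
  obtain ⟨h, hH⟩ := hHb
  set γ : ℝ := max 1
    (4 * (k * (h ^ 2 / (g / (2 * (l + 1)))) + 2 * l * W ^ 2 * h ^ 2) * (l + 1)) with hγdef
  have hγ : 1 ≤ γ := le_max_left _ _
  have hγ0 : 0 < γ := by linarith
  set δ : ℝ := min (g / (2 * p₂ ^ 2)) (1 / 4) with hδdef
  have hδ : 0 < δ := lt_min (by positivity) (by norm_num)
  set σ : ℝ := 2 * k / p₁ + 2 * W * γ ^ l * l with hσdef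
  have hσ : 0 ≤ σ := by positivity
  -- The radius keeps `e` in the range of the quadratic remainder bound and makes `σ ‖e‖ ‖η‖ ≤ (δ /
  -- 2) ‖e‖²`. Here `σ` may vanish, hence `σ + 1` in the denominator.
  refine locallyUniformlyExpStable_of_lyapunov (m := min (1 / p₂) w₁)
    (M := 1 / p₁ + γ ^ l * W) (δ := δ / 2) (r := min ε (δ / (2 * (σ + 1) * κ)))
    (fun t _ => errorField_zero f C u xhat Qbar P₁ t)
    (lt_min (by positivity) hw₁) (by positivity) (by positivity)
    (lt_min hε (by positivity)) fun t₀ T ht₀ hT e he => ?_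
  obtain ⟨hec, De, hDe, hed⟩ := he.hasDerivWithinAt_apply
  have hI : Set.Icc t₀ T ⊆ Set.Ici 0 := fun t ht => ht₀.trans ht.1
  set z : ℝ → Fin (k + l) → ℝ := fun t => (Q t)ᵀ *ᵥ (e t).ofLp with hzdef
  set z₁ : ℝ → Fin k → ℝ := fun t i => z t (Fin.castAdd l i) with hz₁def
  set z₂ : ℝ → Fin l → ℝ := fun t i => z t (Fin.natAdd k i) with hz₂def
  set Y : ℝ → Fin k → ℝ := fun t => (P₁ t)⁻¹ *ᵥ z₁ t with hYdef
  have hdet : ∀ t, 0 ≤ t → (P₁ t).det ≠ 0 := fun t ht => (hP t ht).1.det_ne_zero hp₁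
  have hPY : ∀ t, 0 ≤ t → P₁ t *ᵥ Y t = z₁ t := fun t ht => by
    rw [hYdef, Matrix.mulVec_mulVec, Matrix.mul_nonsing_inv _ (isUnit_iff_ne_zero.2 (hdet t ht)),
      Matrix.one_mulVec]
  have hzc : ∀ i, ContinuousOn (fun t => z t i) (Set.Icc t₀ T) :=
    continuousOn_mulVec (fun i j => (hQc j i).mono hI) hec
  have hYc : ∀ i, ContinuousOn (fun t => Y t i) (Set.Icc t₀ T) :=
    continuousOn_mulVec (continuousOn_matrix_inv_apply (fun i j => (hPc i j).mono hI)
      fun t ht => hdet t (hI ht)) fun i => hzc _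
  have hzn : ∀ t, 0 ≤ t → z₁ t ⬝ᵥ z₁ t + z₂ t ⬝ᵥ z₂ t = ‖e t‖ ^ 2 := fun t ht => by
    rw [norm_sq_eq_dotProduct, ← orthogonal_dotProduct (hQ.orthogonal ht)]
    simp only [dotProduct, Fin.sum_univ_add]
    rfl
  -- The first bracket equals `z₁ᵀ P₁⁻¹ z₁`; this form can be differentiated without a formula for
  -- the derivative of `Y`.
  refine ⟨fun t => (2 * (z₁ t ⬝ᵥ Y t) - Y t ⬝ᵥ (P₁ t *ᵥ Y t)) +
    ∑ i : Fin l, γ ^ ((i : ℕ) + 1) * (w i t * z₂ t i ^ 2), ?_, fun t ht => ?_,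
    (DA ∪ DQ) ∪ (DP ∪ De), (hDA.union hDQ).union (hDP.union hDe), fun t ht htD her => ?_⟩
  · have hdot : ∀ {a b : ℝ → Fin k → ℝ}, (∀ i, ContinuousOn (fun t => a t i) (Set.Icc t₀ T)) →
        (∀ i, ContinuousOn (fun t => b t i) (Set.Icc t₀ T)) →
        ContinuousOn (fun t => a t ⬝ᵥ b t) (Set.Icc t₀ T) := fun ha hb =>
      continuousOn_finsetSum _ fun i _ => (ha i).mul (hb i)
    refine ContinuousOn.add (ContinuousOn.sub (continuousOn_const.mul (hdot (fun i => hzc _) hYc))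
      (hdot hYc (continuousOn_mulVec (fun i j => (hPc i j).mono hI) hYc))) ?_
    exact continuousOn_finsetSum _ fun i _ => continuousOn_const.mul
      ((hwc i).continuousOn.mul ((hzc _).pow 2))
  · have ht0 := hI ht
    have hb := lyapunov_bounds hp₁ hp₂ hw₁ hγ (hP t ht0).1 (hP t ht0).2
      (w := fun i => w i t) (fun i => hwb i t ht0) hW (Y t) (z₂ t)
    rw [hPY t ht0, hzn t ht0, dotProduct_comm] at hb
    have h1 : 2 * (z₁ t ⬝ᵥ Y t) - Y t ⬝ᵥ (P₁ t *ᵥ Y t) = z₁ t ⬝ᵥ Y t := by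
      rw [hPY t ht0, dotProduct_comm (Y t)]; ring
    simp only [h1]
    exact hb
  · have ht0 : 0 ≤ t := hI ht
    simp only [Set.mem_union, not_or] at htD
    obtain ⟨⟨htA, htQ⟩, htP, hte⟩ := htD
    have hQt := hQ.orthogonal ht0
    set η : Vec (k + l) := taylorRemainder f (e t) (xhat t) (u t) with hηdef
    set ζ : Fin (k + l) → ℝ := (Q t)ᵀ *ᵥ η.ofLp with hζdef
    have hzd : ∀ i, HasDerivWithinAt (fun t => z t i) ((H t *ᵥ z t + ζ) i) (Set.Icc t₀ T) t := by
      intro i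
      have h1 := ((hQd t ht0 htQ).mono hI).transpose.mulVec (hed t ht hte) i
      refine h1.congr_deriv ?_
      exact congrFun (qr_coordinates_derivative (P := P₁ t) (Qbar := Qbar t) (C := C t)
        (A := A t) hQt (e t).ofLp η.ofLp) i
    set F : Mat k l := (H t).submatrix (Fin.castAdd l) (Fin.natAdd k) with hFdef
    set U : Mat l l := (H t).submatrix (Fin.natAdd k) (Fin.natAdd k) with hUdef
    set ζ₁ : Fin k → ℝ := fun i => ζ (Fin.castAdd l i) with hζ₁def
    set ζ₂ : Fin l → ℝ := fun i => ζ (Fin.natAdd k i) with hζ₂def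
    set B := qrB (A t) (Qbar t) with hBdef
    set Cb := C t * Qbar t with hCbdef
    have hz₁d : ∀ i, HasDerivWithinAt (fun t => z₁ t i)
        (((B - P₁ t * Cbᵀ * Cb) *ᵥ (P₁ t *ᵥ Y t) + (F *ᵥ z₂ t + ζ₁)) i) (Set.Icc t₀ T) t := by
      intro i
      refine (hzd (Fin.castAdd l i)).congr_deriv ?_
      rw [Pi.add_apply, qrClosedLoop_mulVec_castAdd hQt (hQbar t ht0), hPY t ht0, ← add_assoc]
      rfl
    have hz₂d : ∀ i, HasDerivWithinAt (fun t => z₂ t i) ((U *ᵥ z₂ t) i + ζ₂ i)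
        (Set.Icc t₀ T) t := by
      intro i
      refine (hzd (Fin.natAdd k i)).congr_deriv ?_
      rw [Pi.add_apply, qrClosedLoop_mulVec_natAdd hQt (hQbar t ht0)]
    have hUij : ∀ i j, U i j = qrB (A t) (Q t) (Fin.natAdd k i) (Fin.natAdd k j) :=
      qrClosedLoop_natAdd_natAdd hQt (hQbar t ht0)
    have hU0 : ∀ i j, j < i → U i j = 0 := fun i j hij => by
      rw [hUij, qrB_apply_of_lt]
      exact Nat.add_lt_add_left hij k
    have hPd' := (hPd t ht0 htP).mono hI
    have hYd : ∀ i, DifferentiableWithinAt ℝ (fun t => Y t i) (Set.Icc t₀ T) t := fun i => by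
      simp only [hYdef, Matrix.mulVec, dotProduct]
      exact DifferentiableWithinAt.fun_sum fun j _ =>
        (differentiableWithinAt_matrix_inv_apply (fun r s => (hPd' r s).differentiableWithinAt)
          (hdet t ht0) i j).mul (hz₁d j).differentiableWithinAt
    have hsymm : (P₁ t)ᵀ = P₁ t := (hP t ht0).1.transpose_eq
    have hV₁ := hasDerivWithinAt_two_mul_dotProduct_sub hPd' hz₁d hYd hsymm (hPY t ht0).symm
    have hid := riccati_derivative_eq (B := B) (G := G₁ t) (Cb := Cb) (y := Y t)
      (d := F *ᵥ z₂ t + ζ₁) hsymm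
    have hV₂ : HasDerivWithinAt
        (fun t => ∑ i : Fin l, γ ^ ((i : ℕ) + 1) * (w i t * z₂ t i ^ 2))
        (∑ i : Fin l, γ ^ ((i : ℕ) + 1) * ((-1 - 2 * U i i * w i t) * z₂ t i ^ 2 +
          w i t * (2 * z₂ t i * ((U *ᵥ z₂ t) i + ζ₂ i)))) (Set.Icc t₀ T) t := by
      refine HasDerivWithinAt.fun_sum fun i _ => HasDerivWithinAt.const_mul _ ?_
      refine ((hwd i t (Set.Icc t₀ T) ht0 htA).mul ((hz₂d i).pow 2)).congr_deriv ?_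
      rw [hUij, qrB_apply_self]
      simp
    refine ⟨_, (hV₁.congr_deriv hid).add hV₂, ?_⟩
    have hηn : ζ ⬝ᵥ ζ = ‖η‖ ^ 2 := by
      rw [norm_sq_eq_dotProduct, hζdef, orthogonal_dotProduct hQt]
    have hζ : ∀ i, |ζ i| ≤ ‖η‖ := abs_apply_le_of_dotProduct_self_le (norm_nonneg _) hηn.le
    have hmain := lyapunov_derivative_le hp₁ hp₂ hg hγ hW (le_max_right _ _) (hP t ht0).1
      (hP t ht0).2 (hG t ht0).1 (F := F) (fun i j => hH t ht0 _ _) (U := U)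
      (fun i j => hH t ht0 _ _) hU0 (w := fun i => w i t)
      (fun i => ⟨hw₁.le.trans (hwb i t ht0).1, (hwb i t ht0).2⟩) (y := Y t) (ζ₁ := ζ₁)
      (z := z₂ t) (ζ₂ := ζ₂) (norm_nonneg (e t)) (by rw [hPY t ht0, hzn t ht0])
      (fun i => hζ _) (fun i => hζ _)
    -- The output term `-|C̄ z₁|²` has a favourable sign and is discarded; the decay of the first
    -- block comes from `G₁` and the bounds on `P₁`.
    have hsq := dotProduct_self_nonneg' (Cb *ᵥ (P₁ t *ᵥ Y t))
    have hηe : ‖η‖ ≤ κ * ‖e t‖ ^ 2 := hη _ _ _ (her.trans (min_le_left _ _))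
    have hsmall : σ * (‖e t‖ * ‖η‖) ≤ δ / 2 * ‖e t‖ ^ 2 := by
      have h1 : ‖e t‖ ≤ δ / (2 * (σ + 1) * κ) := her.trans (min_le_right _ _)
      rw [le_div_iff₀ (by positivity)] at h1
      have h2 : σ * (‖e t‖ * ‖η‖) ≤ (σ + 1) * (‖e t‖ * (κ * ‖e t‖ ^ 2)) := by
        gcongr
        linarith
      have h3 := mul_le_mul_of_nonneg_right h1 (sq_nonneg ‖e t‖)
      linarith
    linarith


theorem mainTheorem2 {n m p k : ℕ} (hkn : k ≤ n)
    -- the plant and its output matrix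
    (f : Vec n → Vec m → Vec n) (hf : ∀ v : Vec m, Differentiable ℝ (fun z => f z v))
    (C : ℝ → Mat p n) (hC : ∃ c : ℝ, ∀ t : ℝ, 0 ≤ t → ‖C t‖ ≤ c)
    (u : ℝ → Vec m) (x : ℝ → Vec n) (hx : IsPlantTrajectory f u x)
    -- the observer, driven by the output `y = C x`
    (G₁ : ℝ → Mat k k) (xhat : ℝ → Vec n) (Qbar : ℝ → Mat n k) (P₁ : ℝ → Mat k k)
    (hobs : IsExtendedSubspaceObserver f C u (fun t => matVec (C t) (x t)) G₁ xhat Qbar P₁)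
    (hA : PiecewiseContinuous (jacobianAlong f xhat u))
    -- the choice `j* ≤ k` of the number of columns of `Q̄`, where `Q = [Q̄  Q̄⊥]`
    (Q : ℝ → Mat n n) (hQ : IsFullQR (jacobianAlong f xhat u) Q)
    (hpart : ∀ t : ℝ, 0 ≤ t → ∀ (i : Fin n) (j : Fin k), Qbar t i j = Q t i (Fin.castLE hkn j))
    (hjk : jStar (jacobianAlong f xhat u) Q ≤ k)
    -- (a1) the Jacobian along the estimate is bounded
    (a1 : ∃ a : ℝ, ∀ t : ℝ, 0 ≤ t → ‖jacobianAlong f xhat u t‖ ≤ a)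
    -- (a2) `P₁` is bounded above and below
    (a2 : ∃ p₁ p₂ : ℝ, 0 < p₁ ∧ 0 < p₂ ∧ ∀ t : ℝ, 0 ≤ t →
      LoewnerLE (p₁ • (1 : Mat k k)) (P₁ t) ∧ LoewnerLE (P₁ t) (p₂ • (1 : Mat k k)))
    -- (a3) the Taylor remainder is bounded quadratically
    (a3 : ∃ ε κ : ℝ, 0 < ε ∧ 0 < κ ∧ ∀ (e z : Vec n) (v : Vec m), ‖e‖ ≤ ε →
      ‖taylorRemainder f e z v‖ ≤ κ * ‖e‖ ^ 2) :
    -- the estimation error obeys the error dynamics, which is stable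
    SolvesOn (Set.Ici 0) (fun t => x t - xhat t)
      (fun t => errorField f C u xhat Qbar P₁ t (x t - xhat t)) ∧
    LocallyUniformlyExpStable (errorField f C u xhat Qbar P₁) := by
  refine ⟨?_, ?_⟩
  · have h := hx.sub hobs.estimate
    simpa only [errorField_sub] using h
  -- Writing `n = k + l` turns the partition of `Q` into the index maps `Fin.castAdd` and
  -- `Fin.natAdd`; the former agrees with `Fin.castLE` by definition.
  · obtain ⟨l, rfl⟩ := Nat.exists_eq_add_of_le hkn
    exact errorField_locallyUniformlyExpStable hC hobs hA hQ
      (fun t ht => Matrix.ext fun i j => hpart t ht i j) hjk a1 a2 a3
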